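/- Let $n\ge 3$ be an odd integer, let $\mathbb k$ be an algebraically closed field of characteristic $0$, and let $q\in\mathbb k$ be a primitive $n$th root of unity. Let $D_n$ be the Hopf algebra over $\mathbb k$ (the Drinfeld double of the Taft algebra) with generators $a,b,c,d$ and relations $$ba=qab,\quad db=qbd,\quad ca=qac,\quad dc=qcd,\quad bc=cb,\quad da-q\,ad=1-bc,\quad a^n=0=d^n,\quad b^n=1=c^n,$$ with $\Delta(a)=a\otimes b+1\otimes a$, $\Delta(d)=d\otimes c+1\otimes d$, $\Delta(b)=b\otimes b$, $\Delta(c)=c\otimes c$. For $1\le \ell\le n$ and $s\in\mathbb Z_n=\mathbb Z/n\mathbb Z$ let $V(\ell,s)$ be the simple $D_n$-module with basis $v_1,\dots,v_\ell$ and action $a v_t=v_{t+1}$ ($t<\ell$), $a v_\ell=0$, $b v_t=q^{s+t-1}v_t$, $c v_t=q^{t-(s+\ell)}v_t$, $d v_1=0$, $d v_t=\frac{(q^{t-1}-1)(1-q^{t-1-\ell})}{q-1}\,v_{t-1}$ ($t>1$), and let $\eta_{\ell,s}(x)$ be the trace of $x\in D_n$ on $V(\ell,s)$. Write $\mathrm{Tr}_S(x)=(\eta_{\ell,s}(x))_{(\ell,s)}\in\mathbb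 k^{n^2}$. Let $V=V(2,0)$ and let $M_V$ be the $n^2\times n^2$ McKay matrix whose $\big((\ell,s),(\ell',s')\big)$ entry is the composition multiplicity $[V(\ell,s)\otimes V:V(\ell',s')]$. Let $\mathcal U_m(t)=U_m(t/2)$ with $U_m$ the Chebyshev polynomials of the second kind, and for $j,r\in\mathbb Z_n$ put $\lambda_{j,r}=q^r(q^j+q^{-j})$ and let $\mathbf v_{j,r}\in\mathbb k^{n^2}$ be the vector with $(\ell,s)$ entry $q^{(\ell-1)r}\,\mathcal U_{\ell-1}(q^j+q^{-j})\,q^{2rs}$. For $i,k,j,r\in\mathbb Z_n$ consider the condition $$(*)\qquad j=\pm\tfrac{i+k}{2},\qquad r=\tfrac{i-k}{2}\qquad\text{in }\mathbb Z_n .$$ Then the following hold. (a) For all $i,k\in\mathbb Z_n$, $\mathrm{Tr}_S(b^ic^k)$ is a (nonzero) right eigenvector of $M_V$ with eigenvalue $\eta_{2,0}(b^ic^k)=q^i+q^{-k}$, and this eigenvalue equals $\lambda_{j,r}$ whenever $(*)$ holds. Condition $(*)$ is equivalent to: either $i=j+r$ and $k=j-r$, or $i=-j+r$ and $k=-j-r$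 (in $\mathbb Z_n$). For all $i,k$ there are an integer $0\le j\le\frac{n-1}{2}$ and $r\in\mathbb Z_n$ satisfying $(*)$. (b) If $(*)$ holds, then $\mathrm{Tr}_S(b^ic^k)=\mathbf v_{j,r}$, and for all $1\le\ell\le n$ and $s\in\mathbb Z_n$ $$\eta_{\ell,s}(b^ic^k)=q^{(\ell+2s-1)r}\,\mathcal U_{\ell-1}(q^j+q^{-j}).$$ (c) $\mathrm{Tr}_S(b^ic^k)=\mathrm{Tr}_S(b^{-k}c^{-i})$ for all $i,k\in\mathbb Z_n$; that is, $\eta_{\ell,s}(b^ic^k)=\eta_{\ell,s}(b^{-k}c^{-i})$ for all $1\le \ell\le n$ and $s\in\mathbb Z_n$. (d) The vectors $\mathrm{Tr}_S(b^ic^k)$, $i,k\in\mathbb Z_n$, form a complete set of right eigenvectors of $M_V$: every right eigenvector of $M_V$ in $\mathbb k^{n^2}$ is a nonzero scalar multiple of some $\mathrm{Tr}_S(b^ic^k)$, different vectors among the $\mathrm{Tr}_S(b^ic^k)$ have different eigenvalues, and there are exactly $\frac{n(n+1)}{2}$ different ones. -/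

import Mathlib

open scoped TensorProduct

noncomputable section

/-! ## A vanishing statement for `q`-commuting elements

It is needed only to see that the coproduct of the double respects `a ^ n = 0 = d ^ n`. -/

namespace QBinom

variable {k : Type*} [Field k]

/-- Gaussian binomial coefficients, by the `q`-Pascal rule. -/
def gauss (q : k) : ℕ → ℕ → k
  | _, 0 => 1
  | 0, _ + 1 => 0
  | m + 1, j + 1 => q ^ (j + 1) * gauss q m (j + 1) + gauss q m j

lemma gauss_zero (q : k) (m : ℕ) : gauss q m 0 = 1 := by
  cases m <;> rfl

lemma gauss_succ (q : k) (m j : ℕ) :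
    gauss q (m + 1) (j + 1) = q ^ (j + 1) * gauss q m (j + 1) + gauss q m j := rfl

lemma gauss_eq_zero (q : k) : ∀ m j : ℕ, m < j → gauss q m j = 0
  | _, 0, h => absurd h (Nat.not_lt_zero _)
  | 0, _ + 1, _ => rfl
  | m + 1, j + 1, h => by
    rw [gauss_succ, gauss_eq_zero q m (j + 1) (by omega), gauss_eq_zero q m j (by omega)]
    simp

lemma absorb (q : k) (m : ℕ) : ∀ j : ℕ,
    (1 - q ^ (j + 1)) * gauss q (m + 1) (j + 1) = (1 - q ^ (m + 1)) * gauss q m j := by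
  induction m with
  | zero =>
    intro j
    cases j with
    | zero => simp [gauss]
    | succ j => simp [gauss]
  | succ m ih =>
    intro j
    cases j with
    | zero =>
      have h := ih 0
      rw [gauss_zero] at h
      rw [gauss_succ, gauss_zero]
      linear_combination q * h
    | succ i =>
      have h1 := ih (i + 1)
      have h2 := ih i
      have h3 := gauss_succ q m i
      rw [gauss_succ q (m + 1) (i + 1)]
      linear_combination q ^ (i + 2) * h1 - q * (1 - q ^ (m + 1)) * h3 + q * h2

variable {B : Type*} [Ring B] [Algebra k B]

lemma mul_pow_of_qcomm {q : k} {X Y : B} (h : X * Y = q • (Y * X)) (j : ℕ) :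
    X * Y ^ j = q ^ j • (Y ^ j * X) := by
  induction j with
  | zero => simp
  | succ j ih =>
    rw [pow_succ, ← mul_assoc, ih, smul_mul_assoc, mul_assoc, h, mul_smul_comm, smul_smul,
      ← mul_assoc, pow_succ]

lemma add_pow_of_qcomm {q : k} {X Y : B} (h : X * Y = q • (Y * X)) (m : ℕ) :
    (X + Y) ^ m = ∑ j ∈ Finset.range (m + 1), gauss q m j • (Y ^ j * X ^ (m - j)) := by
  induction m with
  | zero => simp [gauss]
  | succ m ih =>
    have hX : ∀ j ∈ Finset.range (m + 1), X * (gauss q m j • (Y ^ j * X ^ (m - j))) =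
        (q ^ j * gauss q m j) • (Y ^ j * X ^ (m + 1 - j)) := by
      intro j hj
      have hj' : m + 1 - j = (m - j) + 1 := by
        have := Finset.mem_range.mp hj
        omega
      rw [mul_smul_comm, ← mul_assoc, mul_pow_of_qcomm h, smul_mul_assoc, smul_smul, hj',
        pow_succ' X, mul_assoc, mul_comm (gauss q m j)]
    have hY : ∀ j ∈ Finset.range (m + 1), Y * (gauss q m j • (Y ^ j * X ^ (m - j))) =
        gauss q m j • (Y ^ (j + 1) * X ^ (m + 1 - (j + 1))) := by
      intro j _
      rw [mul_smul_comm, ← mul_assoc, ← pow_succ', Nat.add_sub_add_right]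
    rw [pow_succ', ih, add_mul, Finset.mul_sum, Finset.mul_sum, Finset.sum_congr rfl hX,
      Finset.sum_congr rfl hY, Finset.sum_range_succ' _ (m + 1)]
    simp only [gauss_succ, add_smul, Finset.sum_add_distrib]
    rw [Finset.sum_range_succ (fun j => (q ^ (j + 1) * gauss q m (j + 1)) •
      (Y ^ (j + 1) * X ^ (m + 1 - (j + 1)))), gauss_eq_zero q m (m + 1) (Nat.lt_succ_self m),
      Finset.sum_range_succ' (fun j => (q ^ j * gauss q m j) • (Y ^ j * X ^ (m + 1 - j)))]
    simp only [gauss_zero, mul_zero, zero_smul, add_zero, pow_zero, mul_one, one_mul, one_smul,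
      Nat.sub_zero]
    abel

lemma add_pow_eq_zero {n : ℕ} {q : k} (hq : IsPrimitiveRoot q n) {X Y : B}
    (h : X * Y = q • (Y * X)) (hX : X ^ n = 0) (hY : Y ^ n = 0) : (X + Y) ^ n = 0 := by
  rw [add_pow_of_qcomm h]
  refine Finset.sum_eq_zero fun j hj => ?_
  have hj := Finset.mem_range.mp hj
  rcases Nat.eq_zero_or_pos j with rfl | h0
  · simp [hX]
  rcases Nat.lt_or_ge j n with h1 | h1
  · obtain ⟨j, rfl⟩ : ∃ i, j = i + 1 := ⟨j - 1, by omega⟩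
    obtain ⟨m, rfl⟩ : ∃ i, n = i + 1 := ⟨n - 1, by omega⟩
    have h2 := absorb q m j
    rw [hq.pow_eq_one, sub_self, zero_mul] at h2
    rcases mul_eq_zero.mp h2 with h3 | h3
    · exact absurd (sub_eq_zero.mp h3).symm (hq.pow_ne_one_of_pos_of_lt (by omega) h1)
    · rw [h3, zero_smul]
  · obtain rfl : j = n := by omega
    simp [hY]

end QBinom

/-! ## The Drinfeld double of the Taft algebra, by generators and relations -/

/-- The four generators. -/
inductive DGen
  | a | b | c | d

/-- The defining relations, for four elements of an algebra. -/
structure DRelations {k B : Type*} [Field k] [Ring B] [Algebra k B] (n : ℕ) (q : k)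
    (a b c d : B) : Prop where
  ba : b * a = q • (a * b)
  db : d * b = q • (b * d)
  ca : c * a = q • (a * c)
  dc : d * c = q • (c * d)
  bc : b * c = c * b
  da : d * a - q • (a * d) = 1 - b * c
  an : a ^ n = 0
  dn : d ^ n = 0
  bn : b ^ n = 1
  cn : c ^ n = 1

section Presentation

variable {k : Type*} [Field k] (n : ℕ) (q : k)

local notation "gA" => FreeAlgebra.ι k DGen.a
local notation "gB" => FreeAlgebra.ι k DGen.b
local notation "gC" => FreeAlgebra.ι k DGen.c
local notation "gD" => FreeAlgebra.ι k DGen.d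

/-- The same relations as a relation on the free algebra. -/
inductive DRel : FreeAlgebra k DGen → FreeAlgebra k DGen → Prop
  | ba : DRel (gB * gA) (q • (gA * gB))
  | db : DRel (gD * gB) (q • (gB * gD))
  | ca : DRel (gC * gA) (q • (gA * gC))
  | dc : DRel (gD * gC) (q • (gC * gD))
  | bc : DRel (gB * gC) (gC * gB)
  | da : DRel (gD * gA - q • (gA * gD)) (1 - gB * gC)
  | an : DRel (gA ^ n) 0
  | dn : DRel (gD ^ n) 0
  | bn : DRel (gB ^ n) 1
  | cn : DRel (gC ^ n) 1

/-- The algebra `D_n` over `k`: the free algebra on `a, b, c, d` modulo the relations. -/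
def DAlg : Type _ := RingQuot (DRel n q)

namespace DAlg

instance : Ring (DAlg n q) := inferInstanceAs (Ring (RingQuot (DRel n q)))

instance : Algebra k (DAlg n q) := inferInstanceAs (Algebra k (RingQuot (DRel n q)))

/-- The canonical surjection from the free algebra. -/
def mk : FreeAlgebra k DGen →ₐ[k] DAlg n q := RingQuot.mkAlgHom k (DRel n q)

/-- The generator `a` of `D_n`. -/
def a : DAlg n q := mk n q gA

/-- The generator `b` of `D_n`. -/
def b : DAlg n q := mk n q gB

/-- The generator `c` of `D_n`. -/
def c : DAlg n q := mk n q gC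

/-- The generator `d` of `D_n`. -/
def d : DAlg n q := mk n q gD

lemma mk_eq {x y : FreeAlgebra k DGen} (h : DRel n q x y) : mk n q x = mk n q y :=
  RingQuot.mkAlgHom_rel k h

lemma relations : DRelations n q (a n q) (b n q) (c n q) (d n q) where
  ba := by simpa using! mk_eq n q (.ba)
  db := by simpa using! mk_eq n q (.db)
  ca := by simpa using! mk_eq n q (.ca)
  dc := by simpa using! mk_eq n q (.dc)
  bc := by simpa using! mk_eq n q (.bc)
  da := by simpa using! mk_eq n q (.da)
  an := by simpa using! mk_eq n q (.an)
  dn := by simpa using! mk_eq n q (.dn)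
  bn := by simpa using! mk_eq n q (.bn)
  cn := by simpa using! mk_eq n q (.cn)

variable {n q} {B : Type*} [Ring B] [Algebra k B]

/-- The universal property of the presentation. -/
def lift {a' b' c' d' : B} (h : DRelations n q a' b' c' d') : DAlg n q →ₐ[k] B :=
  RingQuot.liftAlgHom k ⟨FreeAlgebra.lift k
    (fun g : DGen => match g with | .a => a' | .b => b' | .c => c' | .d => d'), by
      intro x y hxy
      cases hxy
      · simpa using h.ba
      · simpa using h.db
      · simpa using h.ca
      · simpa using h.dc
      · simpa using h.bc
      · simpa using h.da
      · simpa using h.an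
      · simpa using h.dn
      · simpa using h.bn
      · simpa using h.cn⟩

variable {a' b' c' d' : B} (h : DRelations n q a' b' c' d')

@[simp] lemma lift_a : lift h (a n q) = a' := by
  unfold lift a mk
  erw [RingQuot.liftAlgHom_mkAlgHom_apply]
  simp

@[simp] lemma lift_b : lift h (b n q) = b' := by
  unfold lift b mk
  erw [RingQuot.liftAlgHom_mkAlgHom_apply]
  simp

@[simp] lemma lift_c : lift h (c n q) = c' := by
  unfold lift c mk
  erw [RingQuot.liftAlgHom_mkAlgHom_apply]
  simp

@[simp] lemma lift_d : lift h (d n q) = d' := by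
  unfold lift d mk
  erw [RingQuot.liftAlgHom_mkAlgHom_apply]
  simp

lemma hom_ext {f g : DAlg n q →ₐ[k] B} (ha : f (a n q) = g (a n q)) (hb : f (b n q) = g (b n q))
    (hc : f (c n q) = g (c n q)) (hd : f (d n q) = g (d n q)) : f = g := by
  refine RingQuot.ringQuot_ext' k (s := DRel n q) f g ?_
  ext x
  cases x
  · exact ha
  · exact hb
  · exact hc
  · exact hd

/-! ### Coproduct and counit -/

section Bialgebra

local notation "A" => a n q
local notation "Bg" => b n q
local notation "C" => c n q
local notation "D" => d n q

lemma comul_relations [hq : Fact (IsPrimitiveRoot q n)] : DRelations n q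
    (A ⊗ₜ[k] Bg + 1 ⊗ₜ[k] A : DAlg n q ⊗[k] DAlg n q) (Bg ⊗ₜ[k] Bg) (C ⊗ₜ[k] C)
    (D ⊗ₜ[k] C + 1 ⊗ₜ[k] D) where
  ba := by
    simp only [mul_add, add_mul, Algebra.TensorProduct.tmul_mul_tmul, mul_one, one_mul, smul_add,
      (relations n q).ba, TensorProduct.smul_tmul', TensorProduct.tmul_smul]
  db := by
    simp only [mul_add, add_mul, Algebra.TensorProduct.tmul_mul_tmul, mul_one, one_mul, smul_add,
      (relations n q).db, (relations n q).bc, TensorProduct.smul_tmul', TensorProduct.tmul_smul]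
  ca := by
    simp only [mul_add, add_mul, Algebra.TensorProduct.tmul_mul_tmul, mul_one, one_mul, smul_add,
      (relations n q).ca, (relations n q).bc, TensorProduct.smul_tmul', TensorProduct.tmul_smul]
  dc := by
    simp only [mul_add, add_mul, Algebra.TensorProduct.tmul_mul_tmul, mul_one, one_mul, smul_add,
      (relations n q).dc, TensorProduct.smul_tmul', TensorProduct.tmul_smul]
  bc := by
    simp only [Algebra.TensorProduct.tmul_mul_tmul, (relations n q).bc]
  da := by
    have h : D * A = q • (A * D) + (1 - Bg * C) := by
      rw [← (relations n q).da]
      abel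
    simp only [mul_add, add_mul, Algebra.TensorProduct.tmul_mul_tmul, mul_one, one_mul, smul_add,
      h, (relations n q).ca, (relations n q).db, (relations n q).bc, TensorProduct.smul_tmul',
      TensorProduct.tmul_smul, TensorProduct.add_tmul, TensorProduct.tmul_add,
      TensorProduct.sub_tmul, TensorProduct.tmul_sub, Algebra.TensorProduct.one_def]
    abel
  an := by
    refine QBinom.add_pow_eq_zero hq.out ?_ ?_ ?_
    · simp only [Algebra.TensorProduct.tmul_mul_tmul, mul_one, one_mul, (relations n q).ba,
        TensorProduct.tmul_smul]
    · simp [Algebra.TensorProduct.tmul_pow, (relations n q).an]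
    · simp [Algebra.TensorProduct.tmul_pow, (relations n q).an]
  dn := by
    rw [add_comm]
    refine QBinom.add_pow_eq_zero hq.out ?_ ?_ ?_
    · simp only [Algebra.TensorProduct.tmul_mul_tmul, mul_one, one_mul, (relations n q).dc,
        TensorProduct.tmul_smul]
    · simp [Algebra.TensorProduct.tmul_pow, (relations n q).dn]
    · simp [Algebra.TensorProduct.tmul_pow, (relations n q).dn]
  bn := by simp [Algebra.TensorProduct.tmul_pow, (relations n q).bn, Algebra.TensorProduct.one_def]
  cn := by simp [Algebra.TensorProduct.tmul_pow, (relations n q).cn, Algebra.TensorProduct.one_def]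

lemma counit_relations [NeZero n] : DRelations n q (0 : k) 1 1 0 where
  ba := by simp
  db := by simp
  ca := by simp
  dc := by simp
  bc := by simp
  da := by simp
  an := zero_pow (NeZero.ne n)
  dn := zero_pow (NeZero.ne n)
  bn := by simp
  cn := by simp

variable [NeZero n] [hq : Fact (IsPrimitiveRoot q n)]

/-- The coproduct `Δ(a) = a ⊗ b + 1 ⊗ a`, `Δ(b) = b ⊗ b`, `Δ(c) = c ⊗ c`,
`Δ(d) = d ⊗ c + 1 ⊗ d`. -/
def comulHom : DAlg n q →ₐ[k] DAlg n q ⊗[k] DAlg n q := lift comul_relations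

/-- The counit `ε(a) = ε(d) = 0`, `ε(b) = ε(c) = 1`. -/
def counitHom : DAlg n q →ₐ[k] k := lift counit_relations

instance : Bialgebra k (DAlg n q) :=
  Bialgebra.ofAlgHom comulHom counitHom
    (by
      apply hom_ext <;>
        simp [comulHom, TensorProduct.add_tmul, TensorProduct.tmul_add,
          Algebra.TensorProduct.one_def, add_assoc])
    (by apply hom_ext <;> simp [comulHom, counitHom])
    (by apply hom_ext <;> simp [comulHom, counitHom])

end Bialgebra

/-! ### Antipode -/

section Antipode

/-- The inverse `b⁻¹ = b ^ (n - 1)`. -/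
def bInv (n : ℕ) (q : k) : DAlg n q := b n q ^ (n - 1)

/-- The inverse `c⁻¹ = c ^ (n - 1)`. -/
def cInv (n : ℕ) (q : k) : DAlg n q := c n q ^ (n - 1)

local notation "A" => a n q
local notation "Bg" => b n q
local notation "C" => c n q
local notation "D" => d n q
local notation "Bi" => bInv n q
local notation "Ci" => cInv n q

lemma b_bInv [NeZero n] : Bg * Bi = 1 := by
  rw [bInv, ← pow_succ', Nat.sub_add_cancel (NeZero.one_le), (relations n q).bn]

lemma bInv_b [NeZero n] : Bi * Bg = 1 := by
  rw [bInv, ← pow_succ, Nat.sub_add_cancel (NeZero.one_le), (relations n q).bn]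

lemma c_cInv [NeZero n] : C * Ci = 1 := by
  rw [cInv, ← pow_succ', Nat.sub_add_cancel (NeZero.one_le), (relations n q).cn]

lemma cInv_c [NeZero n] : Ci * C = 1 := by
  rw [cInv, ← pow_succ, Nat.sub_add_cancel (NeZero.one_le), (relations n q).cn]

lemma bInv_pow : Bi ^ n = 1 := by
  rw [bInv, ← pow_mul, mul_comm, pow_mul, (relations n q).bn, one_pow]

lemma cInv_pow : Ci ^ n = 1 := by
  rw [cInv, ← pow_mul, mul_comm, pow_mul, (relations n q).cn, one_pow]

lemma bInv_cInv : Bi * Ci = Ci * Bi :=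
  (Commute.pow_pow (relations n q).bc (n - 1) (n - 1)).eq

/-- If `x` has inverse `y` and `x z = q z x`, then `z y = q y z`. -/
lemma inv_qcomm {x y z : DAlg n q} (hxy : x * y = 1) (hyx : y * x = 1)
    (h : x * z = q • (z * x)) : z * y = q • (y * z) := by
  calc z * y = y * (x * z) * y := by rw [← mul_assoc, hyx, one_mul]
    _ = q • (y * z * (x * y)) := by
      rw [h, mul_smul_comm, smul_mul_assoc, mul_assoc, mul_assoc, mul_assoc]
    _ = q • (y * z) := by rw [hxy, mul_one]

lemma inv_qcomm' {x y z : DAlg n q} (hxy : x * y = 1) (hyx : y * x = 1)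
    (h : z * x = q • (x * z)) : y * z = q • (z * y) := by
  calc y * z = y * (z * x) * y := by rw [mul_assoc, mul_assoc, hxy, mul_one]
    _ = q • ((y * x) * z * y) := by
      rw [h, mul_smul_comm, smul_mul_assoc]
      simp only [mul_assoc]
    _ = q • (z * y) := by rw [hyx, one_mul]

lemma a_bInv [NeZero n] : A * Bi = q • (Bi * A) := inv_qcomm b_bInv bInv_b (relations n q).ba

lemma a_cInv [NeZero n] : A * Ci = q • (Ci * A) := inv_qcomm c_cInv cInv_c (relations n q).ca

lemma bInv_d [NeZero n] : Bi * D = q • (D * Bi) := inv_qcomm' b_bInv bInv_b (relations n q).db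

lemma cInv_d [NeZero n] : Ci * D = q • (D * Ci) := inv_qcomm' c_cInv cInv_c (relations n q).dc

/-- If `x` and `y` commute up to a nonzero scalar and `x ^ m = 0`, then `(x y) ^ m = 0`. -/
lemma mul_pow_eq_zero {x y : DAlg n q} {s : k} (h : y * x = s • (x * y)) {m : ℕ}
    (hx : x ^ m = 0) : (x * y) ^ m = 0 := by
  have key : ∀ j : ℕ, ∃ t : k, (x * y) ^ j = t • (x ^ j * y ^ j) := by
    intro j
    induction j with
    | zero => exact ⟨1, by simp⟩
    | succ j ih =>
      obtain ⟨t, ht⟩ := ih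
      refine ⟨t * s ^ j, ?_⟩
      rw [pow_succ', ht, mul_smul_comm, mul_assoc x y, ← mul_assoc y, QBinom.mul_pow_of_qcomm h,
        smul_mul_assoc, mul_smul_comm, smul_smul, pow_succ' x, pow_succ' y]
      simp only [mul_assoc]
  obtain ⟨t, ht⟩ := key m
  rw [ht, hx, zero_mul, smul_zero]

open MulOpposite in
lemma antipode_relations [NeZero n] [hq : Fact (IsPrimitiveRoot q n)] :
    DRelations n q (op (-(A * Bi))) (op Bi) (op Ci) (op (-(D * Ci))) where
  ba := by
    rw [← op_mul, ← op_mul, ← op_smul, neg_mul, mul_neg, smul_neg, ← mul_assoc Bi,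
      ← smul_mul_assoc, ← a_bInv]
  db := by
    rw [← op_mul, ← op_mul, ← op_smul, neg_mul, mul_neg, smul_neg, ← mul_assoc Bi, bInv_d,
      smul_mul_assoc, mul_assoc, mul_assoc, bInv_cInv]
  ca := by
    rw [← op_mul, ← op_mul, ← op_smul, neg_mul, mul_neg, smul_neg, ← mul_assoc Ci,
      ← smul_mul_assoc, ← a_cInv, mul_assoc, mul_assoc, bInv_cInv]
  dc := by
    rw [← op_mul, ← op_mul, ← op_smul, neg_mul, mul_neg, smul_neg, ← mul_assoc Ci, cInv_d,
      smul_mul_assoc]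
  bc := by rw [← op_mul, ← op_mul, bInv_cInv]
  da := by
    have hq0 : q ≠ 0 := hq.out.ne_zero (NeZero.ne n)
    have h1 : A * Bi * (D * Ci) = q • (A * D * (Bi * Ci)) := by
      rw [mul_assoc, ← mul_assoc Bi, bInv_d, smul_mul_assoc, mul_smul_comm]
      simp only [mul_assoc]
    have h2 : q • (D * Ci * (A * Bi)) = D * A * (Bi * Ci) := by
      rw [mul_assoc, ← mul_assoc Ci, ← mul_smul_comm, ← smul_mul_assoc, ← a_cInv, bInv_cInv]
      simp only [mul_assoc]
    have h3 : Bg * C * (Bi * Ci) = 1 := by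
      rw [bInv_cInv, mul_assoc, ← mul_assoc C, c_cInv, one_mul, b_bInv]
    rw [← op_mul, ← op_mul, ← op_mul, ← op_smul, ← op_sub, ← op_one, ← op_sub, neg_mul_neg,
      neg_mul_neg, h1, h2, ← smul_mul_assoc, ← sub_mul, ← neg_sub, (relations n q).da, ← bInv_cInv,
      neg_mul, sub_mul, h3, one_mul, neg_sub]
  an := by
    have hq0 : q ≠ 0 := hq.out.ne_zero (NeZero.ne n)
    rw [← op_pow, neg_pow, mul_pow_eq_zero (s := q⁻¹), mul_zero, op_zero]
    · rw [a_bInv, smul_smul, inv_mul_cancel₀ hq0, one_smul]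
    · exact (relations n q).an
  dn := by
    rw [← op_pow, neg_pow, mul_pow_eq_zero (s := q), mul_zero, op_zero]
    · exact cInv_d
    · exact (relations n q).dn
  bn := by rw [← op_pow, bInv_pow, op_one]
  cn := by rw [← op_pow, cInv_pow, op_one]

lemma induction {P : DAlg n q → Prop} (h1 : ∀ r : k, P (algebraMap k _ r)) (ha : P A) (hb : P Bg)
    (hc : P C) (hd : P D) (hmul : ∀ x y, P x → P y → P (x * y))
    (hadd : ∀ x y, P x → P y → P (x + y)) (x : DAlg n q) : P x := by
  obtain ⟨y, rfl⟩ := RingQuot.mkAlgHom_surjective k (DRel n q) x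
  change P (mk n q y)
  induction y using FreeAlgebra.induction with
  | grade0 r => simpa using h1 r
  | grade1 g =>
    cases g
    · exact ha
    · exact hb
    · exact hc
    · exact hd
  | mul x y hx hy => simpa using hmul _ _ hx hy
  | add x y hx hy => simpa using hadd _ _ hx hy

variable [NeZero n] [hq : Fact (IsPrimitiveRoot q n)]

/-- The antipode as an algebra map to the opposite algebra:
`S(a) = -a b⁻¹`, `S(b) = b⁻¹`, `S(c) = c⁻¹`, `S(d) = -d c⁻¹`. -/
def antipodeHom : DAlg n q →ₐ[k] (DAlg n q)ᵐᵒᵖ := lift antipode_relations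

/-- The antipode as a linear map. -/
def antipodeLin : DAlg n q →ₗ[k] DAlg n q :=
  (MulOpposite.opLinearEquiv k).symm.toLinearMap ∘ₗ antipodeHom.toLinearMap

lemma antipodeLin_apply (x : DAlg n q) :
    antipodeLin x = MulOpposite.unop (antipodeHom x) := rfl

lemma antipodeLin_mul (x y : DAlg n q) :
    antipodeLin (x * y) = antipodeLin y * antipodeLin x := by
  simp [antipodeLin_apply]

local notation "Φ" => LinearMap.mul' k (DAlg n q) ∘ₗ antipodeLin.rTensor (DAlg n q)
local notation "Ψ" => LinearMap.mul' k (DAlg n q) ∘ₗ antipodeLin.lTensor (DAlg n q)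

lemma phi_mul (u : DAlg n q ⊗[k] DAlg n q) (y z : DAlg n q) :
    (Φ) (u * (y ⊗ₜ z)) = antipodeLin y * (Φ) u * z := by
  induction u using TensorProduct.induction_on with
  | zero => simp
  | tmul p r => simp [antipodeLin_mul, mul_assoc]
  | add u v hu hv => rw [add_mul, map_add, hu, hv, map_add, mul_add, add_mul]

lemma psi_mul (u : DAlg n q ⊗[k] DAlg n q) (y z : DAlg n q) :
    (Ψ) ((y ⊗ₜ z) * u) = y * (Ψ) u * antipodeLin z := by
  induction u using TensorProduct.induction_on with
  | zero => simp
  | tmul p r => simp [antipodeLin_mul, mul_assoc]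
  | add u v hu hv => rw [mul_add, map_add, hu, hv, map_add, mul_add, add_mul]

lemma phi_mul_of {u : DAlg n q ⊗[k] DAlg n q} {e : k} (hu : (Φ) u = algebraMap k _ e)
    (v : DAlg n q ⊗[k] DAlg n q) : (Φ) (u * v) = e • (Φ) v := by
  induction v using TensorProduct.induction_on with
  | zero => simp
  | tmul p r => rw [phi_mul, hu, ← Algebra.commutes, ← Algebra.smul_def]; simp
  | add v w hv hw => rw [mul_add, map_add, hv, hw, map_add, smul_add]

lemma psi_mul_of {v : DAlg n q ⊗[k] DAlg n q} {e : k} (hv : (Ψ) v = algebraMap k _ e)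
    (u : DAlg n q ⊗[k] DAlg n q) : (Ψ) (u * v) = e • (Ψ) u := by
  induction u using TensorProduct.induction_on with
  | zero => simp
  | tmul p r => rw [psi_mul, hv, ← Algebra.commutes, ← Algebra.smul_def]; simp
  | add v w hv hw => rw [add_mul, map_add, hv, hw, map_add, smul_add]

lemma phi_comul (x : DAlg n q) : (Φ) (comulHom x) = algebraMap k _ (counitHom x) := by
  induction x using induction with
  | h1 r => simp [antipodeLin_apply, Algebra.TensorProduct.algebraMap_apply]
  | ha => simp [comulHom, counitHom, antipodeLin_apply, antipodeHom, mul_assoc, bInv_b]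
  | hb => simp [comulHom, counitHom, antipodeLin_apply, antipodeHom, bInv_b]
  | hc => simp [comulHom, counitHom, antipodeLin_apply, antipodeHom, cInv_c]
  | hd => simp [comulHom, counitHom, antipodeLin_apply, antipodeHom, mul_assoc, cInv_c]
  | hmul x y hx hy => rw [map_mul, phi_mul_of hx, hy, map_mul, map_mul, Algebra.smul_def]
  | hadd x y hx hy => rw [map_add, map_add, hx, hy, map_add, map_add]

lemma psi_comul (x : DAlg n q) : (Ψ) (comulHom x) = algebraMap k _ (counitHom x) := by
  induction x using induction with
  | h1 r => simp [antipodeLin_apply, Algebra.TensorProduct.algebraMap_apply]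
  | ha => simp [comulHom, counitHom, antipodeLin_apply, antipodeHom]
  | hb => simp [comulHom, counitHom, antipodeLin_apply, antipodeHom, b_bInv]
  | hc => simp [comulHom, counitHom, antipodeLin_apply, antipodeHom, c_cInv]
  | hd => simp [comulHom, counitHom, antipodeLin_apply, antipodeHom]
  | hmul x y hx hy =>
    rw [map_mul, psi_mul_of hy, hx, map_mul, map_mul, Algebra.smul_def,
      ← Algebra.commutes]
  | hadd x y hx hy => rw [map_add, map_add, hx, hy, map_add, map_add]

/-- `D_n` as a Hopf algebra. -/
instance : HopfAlgebra k (DAlg n q) where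
  antipode := antipodeLin
  mul_antipode_rTensor_comul := LinearMap.ext phi_comul
  mul_antipode_lTensor_comul := LinearMap.ext psi_comul

end Antipode

/-- The element `b ^ i * c ^ m` for residues `i, m` modulo `n`; it is independent of
representatives because `b ^ n = c ^ n = 1`. -/
def grp (n : ℕ) (q : k) (i m : ZMod n) : DAlg n q := b n q ^ i.val * c n q ^ m.val

end DAlg
end Presentation

/-! ## Modules over a bialgebra, tensor products, composition multiplicities -/

section Modules

variable {k A V W : Type*} [Field k] [AddCommGroup V] [Module k V] [AddCommGroup W] [Module k W]

/-- The `A`-module with underlying space `V` on which `x : A` acts as `ρ x`. -/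
def RepMod [Ring A] [Algebra k A] (_ρ : A →ₐ[k] Module.End k V) : Type _ := V

namespace RepMod

variable [Ring A] [Algebra k A] (ρ : A →ₐ[k] Module.End k V)

instance : AddCommGroup (RepMod ρ) := inferInstanceAs (AddCommGroup V)

instance : Module A (RepMod ρ) := Module.compHom V ρ.toRingHom

lemma smul_def (x : A) (v : RepMod ρ) : x • v = (ρ x (v : V) : V) := rfl

end RepMod

/-- The tensor product of two modules over a bialgebra:
`x` acts as `∑ ρ x₁ ⊗ σ x₂`, where `Δ x = ∑ x₁ ⊗ x₂`. -/
def tensorRep [Ring A] [Bialgebra k A] (ρ : A →ₐ[k] Module.End k V) (σ : A →ₐ[k] Module.End k W) :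
    A →ₐ[k] Module.End k (V ⊗[k] W) :=
  ((Module.endTensorEndAlgHom (R := k) (S := k) (A := k) (M := V) (N := W)).comp
    (Algebra.TensorProduct.map ρ σ)).comp (Bialgebra.comulAlgHom k A)

end Modules

section Multiplicity

variable (A U S : Type*) [Ring A] [AddCommGroup U] [Module A U] [AddCommGroup S] [Module A S]

/-- The number of factors of a composition series of `U` that are isomorphic to `S`. -/
def factorCount {A U : Type*} [Ring A] [AddCommGroup U] [Module A U]
    (s : CompositionSeries (Submodule A U)) (S : Type*) [AddCommGroup S] [Module A S] : ℕ :=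
  Nat.card {t : Fin s.length //
    Nonempty ((s t.succ ⧸ (s t.castSucc).comap (s t.succ).subtype) ≃ₗ[A] S)}

open Classical in
/-- The multiplicity `[U : S]` of `S` as a composition factor of a module `U` of finite length,
counted in any composition series from `0` to `U`. -/
def compMult : ℕ :=
  if h : ∃ s : CompositionSeries (Submodule A U), s.head = ⊥ ∧ s.last = ⊤ then
    factorCount h.choose S
  else 0

/-- Independence of the composition series. -/
lemma compMult_eq (s : CompositionSeries (Submodule A U)) (h0 : s.head = ⊥) (h1 : s.last = ⊤) :
    compMult A U S = factorCount s S := by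
  have h : ∃ s : CompositionSeries (Submodule A U), s.head = ⊥ ∧ s.last = ⊤ := ⟨s, h0, h1⟩
  rw [compMult, dif_pos h]
  obtain ⟨f, hf⟩ := CompositionSeries.jordan_holder h.choose s
    (h.choose_spec.1.trans h0.symm) (h.choose_spec.2.trans h1.symm)
  refine Nat.card_congr (f.subtypeEquiv fun t => ?_)
  have e := (hf t).linearEquiv
  exact ⟨fun ⟨g⟩ => ⟨e.symm.trans g⟩, fun ⟨g⟩ => ⟨e.trans g⟩⟩

end Multiplicity

/-! ## The simple modules `V(ℓ, r)` -/

namespace DAlg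

section Simple

variable {k : Type*} [Field k]

/-- `q ^ x` for a residue `x` modulo `n`, where `q ^ n = 1`. -/
def qpow (q : k) {n : ℕ} (x : ZMod n) : k := q ^ x.val

/-- `α_i(ℓ) = (q ^ i - 1) (1 - q ^ (i - ℓ)) / (q - 1)`. -/
def alpha (q : k) (l i : ℕ) : k := (q ^ i - 1) * (1 - q ^ ((i : ℤ) - l)) / (q - 1)

/-- The standard basis of `k ^ ℓ` numbered from `0`, continued by `0`:
`stdVec ℓ t` is the basis vector `v_{t + 1}` if `t < ℓ`, and `0` otherwise. -/
def stdVec (k : Type*) [Field k] (l t : ℕ) : Fin l → k := fun u => if (u : ℕ) = t then 1 else 0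

/-- The endomorphism of `k ^ ℓ` with prescribed values on the standard basis. -/
def ofBasis (l : ℕ) (f : ℕ → (Fin l → k)) : Module.End k (Fin l → k) :=
  (Pi.basisFun k (Fin l)).constr k fun u => f u

/-- `a v_j = v_{j+1}` for `j < ℓ`, and `a v_ℓ = 0`. -/
def opA (k : Type*) [Field k] (l : ℕ) : Module.End k (Fin l → k) :=
  ofBasis l fun t => stdVec k l (t + 1)

/-- `b v_j = q ^ (r + j - 1) v_j`. -/
def opB (q : k) {n : ℕ} (l : ℕ) (r : ZMod n) : Module.End k (Fin l → k) :=
  ofBasis l fun t => qpow q (r + ((t + 1 : ℕ) : ZMod n) - 1) • stdVec k l t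

/-- `c v_j = q ^ (j - (r + ℓ)) v_j`. -/
def opC (q : k) {n : ℕ} (l : ℕ) (r : ZMod n) : Module.End k (Fin l → k) :=
  ofBasis l fun t => qpow q (((t + 1 : ℕ) : ZMod n) - (r + (l : ZMod n))) • stdVec k l t

/-- `d v_1 = 0` and `d v_j = α_{j-1}(ℓ) v_{j-1}` for `1 < j`. -/
def opD (q : k) (l : ℕ) : Module.End k (Fin l → k) :=
  ofBasis l fun t => if t = 0 then 0 else alpha q l t • stdVec k l (t - 1)

lemma stdVec_eq_zero {l t : ℕ} (h : l ≤ t) : stdVec k l t = 0 := by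
  ext u
  have := u.2
  simp only [stdVec, Pi.zero_apply, ite_eq_right_iff]
  omega

lemma ofBasis_stdVec {l : ℕ} (f : ℕ → (Fin l → k)) {t : ℕ} (h : t < l) :
    ofBasis l f (stdVec k l t) = f t := by
  have : stdVec k l t = Pi.basisFun k (Fin l) ⟨t, h⟩ := by
    ext u
    simp [stdVec, Pi.single_apply, Fin.ext_iff]
  rw [this, ofBasis, Module.Basis.constr_basis]

lemma end_ext {l : ℕ} {f g : Module.End k (Fin l → k)}
    (h : ∀ t < l, f (stdVec k l t) = g (stdVec k l t)) : f = g := by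
  refine (Pi.basisFun k (Fin l)).ext fun u => ?_
  have : Pi.basisFun k (Fin l) u = stdVec k l u := by
    ext u
    simp [stdVec, Pi.single_apply, Fin.ext_iff]
  rw [this]
  exact h u u.2

lemma opA_stdVec (l t : ℕ) : opA k l (stdVec k l t) = stdVec k l (t + 1) := by
  rcases Nat.lt_or_ge t l with h | h
  · rw [opA, ofBasis_stdVec _ h]
  · rw [stdVec_eq_zero h, stdVec_eq_zero (by omega), map_zero]

lemma opB_stdVec (q : k) {n : ℕ} (l : ℕ) (r : ZMod n) (t : ℕ) :
    opB q l r (stdVec k l t) = qpow q (r + ((t + 1 : ℕ) : ZMod n) - 1) • stdVec k l t := by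
  rcases Nat.lt_or_ge t l with h | h
  · rw [opB, ofBasis_stdVec _ h]
  · rw [stdVec_eq_zero h, map_zero, smul_zero]

lemma opC_stdVec (q : k) {n : ℕ} (l : ℕ) (r : ZMod n) (t : ℕ) :
    opC q l r (stdVec k l t) = qpow q (((t + 1 : ℕ) : ZMod n) - (r + (l : ZMod n))) • stdVec k l t := by
  rcases Nat.lt_or_ge t l with h | h
  · rw [opC, ofBasis_stdVec _ h]
  · rw [stdVec_eq_zero h, map_zero, smul_zero]

lemma opD_zero (q : k) (l : ℕ) : opD q l (stdVec k l 0) = 0 := by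
  rcases Nat.lt_or_ge 0 l with h | h
  · rw [opD, ofBasis_stdVec _ h, if_pos rfl]
  · rw [stdVec_eq_zero h, map_zero]

lemma opD_succ (q : k) (l t : ℕ) :
    opD q l (stdVec k l (t + 1)) = alpha q l (t + 1) • stdVec k l t := by
  rcases Nat.lt_or_ge (t + 1) l with h | h
  · rw [opD, ofBasis_stdVec _ h, if_neg (by omega), Nat.add_sub_cancel]
  · rw [stdVec_eq_zero h, map_zero]
    rcases h.eq_or_lt with h | h
    · simp [alpha, h]
    · rw [stdVec_eq_zero (by omega), smul_zero]

lemma opA_pow (l m t : ℕ) : (opA k l ^ m) (stdVec k l t) = stdVec k l (t + m) := by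
  induction m with
  | zero => simp
  | succ m ih => rw [pow_succ', Module.End.mul_apply, ih, opA_stdVec, add_assoc]

lemma opD_pow (q : k) (l m t : ℕ) (h : t < m) : (opD q l ^ m) (stdVec k l t) = 0 := by
  induction m generalizing t with
  | zero => omega
  | succ m ih =>
    rw [pow_succ, Module.End.mul_apply]
    cases t with
    | zero => rw [opD_zero, map_zero]
    | succ t => rw [opD_succ, map_smul, ih t (by omega), smul_zero]

lemma qpow_pow {n : ℕ} {q : k} (hq : IsPrimitiveRoot q n) (x : ZMod n) : qpow q x ^ n = 1 := by
  rw [qpow, ← pow_mul, mul_comm, pow_mul, hq.pow_eq_one, one_pow]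

variable {n : ℕ} {q : k} [NeZero n]

lemma qpow_intCast (hq : IsPrimitiveRoot q n) (z : ℤ) : qpow q (z : ZMod n) = q ^ z := by
  have hq0 : q ≠ 0 := hq.ne_zero (NeZero.ne n)
  have h1 : (((z : ZMod n).val : ℕ) : ℤ) = z % n := ZMod.val_intCast z
  rw [qpow, ← zpow_natCast, h1]
  conv_rhs => rw [← Int.emod_add_mul_ediv z n]
  rw [zpow_add₀ hq0, zpow_mul, zpow_natCast, hq.pow_eq_one, one_zpow, mul_one]

lemma qpow_add (hq : IsPrimitiveRoot q n) (x y : ZMod n) :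
    qpow q (x + y) = qpow q x * qpow q y := by
  have hq0 : q ≠ 0 := hq.ne_zero (NeZero.ne n)
  obtain ⟨x, rfl⟩ := ZMod.intCast_surjective x
  obtain ⟨y, rfl⟩ := ZMod.intCast_surjective y
  rw [← Int.cast_add, qpow_intCast hq, qpow_intCast hq, qpow_intCast hq, zpow_add₀ hq0]

lemma qpow_one (hq : IsPrimitiveRoot q n) : qpow q (1 : ZMod n) = q := by
  simpa using qpow_intCast hq 1

lemma alpha_rel (hq : IsPrimitiveRoot q n) (l t : ℕ) (r : ZMod n) :
    alpha q l (t + 1) - q * alpha q l t =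
      1 - qpow q (r + ((t + 1 : ℕ) : ZMod n) - 1) * qpow q (((t + 1 : ℕ) : ZMod n) - (r + (l : ZMod n))) := by
  have hq0 : q ≠ 0 := hq.ne_zero (NeZero.ne n)
  have h : (r + ((t + 1 : ℕ) : ZMod n) - 1) + (((t + 1 : ℕ) : ZMod n) - (r + (l : ZMod n))) =
      ((2 * t + 1 - l : ℤ) : ZMod n) := by
    push_cast
    ring
  rw [← qpow_add hq, h, qpow_intCast hq]
  by_cases h1 : q = 1
  · simp [alpha, h1]
  have h2 : q - 1 ≠ 0 := sub_ne_zero.mpr h1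
  have e1 : q ^ ((t : ℤ) + 1 - l) = q * q ^ ((t : ℤ) - l) := by
    rw [← zpow_one_add₀ hq0]
    congr 1
    ring
  have e2 : q ^ (2 * (t : ℤ) + 1 - l) = q * q ^ t * q ^ ((t : ℤ) - l) := by
    rw [← zpow_natCast, ← zpow_one_add₀ hq0, ← zpow_add₀ hq0]
    congr 1
    ring
  simp only [alpha, Nat.cast_add, Nat.cast_one, e1, e2]
  field_simp
  ring

lemma op_relations (hq : IsPrimitiveRoot q n) {l : ℕ} (hl : l ≤ n) (r : ZMod n) :
    DRelations n q (opA k l) (opB q l r) (opC q l r) (opD q l) where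
  ba := by
    refine end_ext fun t _ => ?_
    have h : r + ((t + 1 + 1 : ℕ) : ZMod n) - 1 = 1 + (r + ((t + 1 : ℕ) : ZMod n) - 1) := by
      push_cast
      ring
    simp only [Module.End.mul_apply, LinearMap.smul_apply, opA_stdVec, opB_stdVec, map_smul,
      smul_smul]
    rw [h, qpow_add hq, qpow_one hq]
  db := by
    refine end_ext fun t _ => ?_
    cases t with
    | zero => simp [opB_stdVec, opD_zero]
    | succ t =>
      have h : r + ((t + 1 + 1 : ℕ) : ZMod n) - 1 = 1 + (r + ((t + 1 : ℕ) : ZMod n) - 1) := by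
        push_cast
        ring
      simp only [Module.End.mul_apply, LinearMap.smul_apply, opD_succ, opB_stdVec, map_smul,
        smul_smul]
      rw [h, qpow_add hq, qpow_one hq]
      congr 1
      ring
  ca := by
    refine end_ext fun t _ => ?_
    have h : ((t + 1 + 1 : ℕ) : ZMod n) - (r + (l : ZMod n)) = 1 + (((t + 1 : ℕ) : ZMod n) - (r + (l : ZMod n))) := by
      push_cast
      ring
    simp only [Module.End.mul_apply, LinearMap.smul_apply, opA_stdVec, opC_stdVec, map_smul,
      smul_smul]
    rw [h, qpow_add hq, qpow_one hq]
  dc := by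
    refine end_ext fun t _ => ?_
    cases t with
    | zero => simp [opC_stdVec, opD_zero]
    | succ t =>
      have h : ((t + 1 + 1 : ℕ) : ZMod n) - (r + (l : ZMod n)) =
          1 + (((t + 1 : ℕ) : ZMod n) - (r + (l : ZMod n))) := by
        push_cast
        ring
      simp only [Module.End.mul_apply, LinearMap.smul_apply, opD_succ, opC_stdVec, map_smul,
        smul_smul]
      rw [h, qpow_add hq, qpow_one hq]
      congr 1
      ring
  bc := by
    refine end_ext fun t _ => ?_
    simp only [Module.End.mul_apply, opB_stdVec, opC_stdVec, map_smul, smul_smul]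
    rw [mul_comm]
  da := by
    refine end_ext fun t _ => ?_
    have h := alpha_rel hq l t r
    have hR : (1 - opB q l r * opC q l r) (stdVec k l t) =
        (alpha q l (t + 1) - q * alpha q l t) • stdVec k l t := by
      rw [h]
      simp only [LinearMap.sub_apply, Module.End.mul_apply, Module.End.one_apply, opB_stdVec,
        opC_stdVec, map_smul, smul_smul, sub_smul, one_smul]
      rw [mul_comm]
    rw [hR]
    cases t with
    | zero =>
      simp [opA_stdVec, opD_succ, opD_zero, alpha]
    | succ t =>
      simp only [LinearMap.sub_apply, LinearMap.smul_apply, Module.End.mul_apply, opA_stdVec,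
        opD_succ, map_smul, smul_smul, sub_smul]
  an := by
    refine end_ext fun t _ => ?_
    rw [opA_pow, stdVec_eq_zero (by omega), LinearMap.zero_apply]
  dn := by
    refine end_ext fun t _ => ?_
    rw [opD_pow q l n t (by omega), LinearMap.zero_apply]
  bn := by
    refine end_ext fun t _ => ?_
    have h : ∀ m : ℕ, (opB q l r ^ m) (stdVec k l t) =
        qpow q (r + ((t + 1 : ℕ) : ZMod n) - 1) ^ m • stdVec k l t := by
      intro m
      induction m with
      | zero => simp
      | succ m ih => rw [pow_succ', Module.End.mul_apply, ih, map_smul, opB_stdVec, smul_smul,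
          pow_succ]
    rw [h, qpow_pow hq, one_smul, Module.End.one_apply]
  cn := by
    refine end_ext fun t _ => ?_
    have h : ∀ m : ℕ, (opC q l r ^ m) (stdVec k l t) =
        qpow q (((t + 1 : ℕ) : ZMod n) - (r + (l : ZMod n))) ^ m • stdVec k l t := by
      intro m
      induction m with
      | zero => simp
      | succ m ih => rw [pow_succ', Module.End.mul_apply, ih, map_smul, opC_stdVec, smul_smul,
          pow_succ]
    rw [h, qpow_pow hq, one_smul, Module.End.one_apply]

variable [hq : Fact (IsPrimitiveRoot q n)]

/-- The module `V(ℓ, r)`, for `ℓ ≤ n` and `r` modulo `n`, as a representation on `k ^ ℓ`. -/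
def simpleRep (n : ℕ) [NeZero n] (q : k) [hq : Fact (IsPrimitiveRoot q n)]
    (l : ℕ) (hl : l ≤ n) (r : ZMod n) : DAlg n q →ₐ[k] Module.End k (Fin l → k) :=
  lift (op_relations hq.out hl r)

/-- The character `η_{ℓ,s}` of `V(ℓ, s)`. -/
def eta (n : ℕ) [NeZero n] (q : k) [Fact (IsPrimitiveRoot q n)]
    (l : ℕ) (hl : l ≤ n) (s : ZMod n) (x : DAlg n q) : k :=
  LinearMap.trace k (Fin l → k) (simpleRep n q l hl s x)

/-- The pairs `(ℓ, r)` with `1 ≤ ℓ ≤ n` and `r` modulo `n`, which index the simple modules. -/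
abbrev SimpleIdx (n : ℕ) : Type := Finset.Icc 1 n × ZMod n

lemma SimpleIdx.le {n : ℕ} (p : SimpleIdx n) : (p.1 : ℕ) ≤ n := (Finset.mem_Icc.mp p.1.2).2

/-- The trace vector of `x`, whose `(ℓ, s)` entry is `η_{ℓ,s}(x)`. -/
def traceVec (n : ℕ) [NeZero n] (q : k) [Fact (IsPrimitiveRoot q n)] (x : DAlg n q) :
    SimpleIdx n → k :=
  fun p => eta n q p.1 p.le p.2 x

/-- The McKay matrix for tensoring with a module `W`:
its `((ℓ, r), (ℓ', s))` entry is `[V(ℓ, r) ⊗ W : V(ℓ', s)]`. -/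
def mcKay (n : ℕ) [NeZero n] (q : k) [Fact (IsPrimitiveRoot q n)] {W : Type*} [AddCommGroup W]
    [Module k W] (σ : DAlg n q →ₐ[k] Module.End k W) : Matrix (SimpleIdx n) (SimpleIdx n) k :=
  Matrix.of fun p p' =>
    (compMult (DAlg n q) (RepMod (tensorRep (simpleRep n q p.1 p.le p.2) σ))
      (RepMod (simpleRep n q p'.1 p'.le p'.2)) : k)

/-- The rescaled Chebyshev polynomial of the second kind, `𝒰_m(t) = U_m(t / 2)`. -/
def chebU (m : ℕ) (t : k) : k := (Polynomial.Chebyshev.U k m).eval (t / 2)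

/-- The vector `v_{j,r}`: its `(ℓ, s)` entry is
`q ^ ((ℓ - 1) r) 𝒰_{ℓ-1}(q ^ j + q ^ (-j)) q ^ (2 r s)`. -/
def chebVec (q : k) {n : ℕ} (j r : ZMod n) : SimpleIdx n → k := fun p =>
  qpow q (((p.1 - 1 : ℕ) : ZMod n) * r) * chebU (p.1 - 1) (qpow q j + qpow q (-j)) *
    qpow q (2 * r * p.2)

/-- `λ_{j,r} = q ^ r (q ^ j + q ^ (-j))`. -/
def lam (q : k) {n : ℕ} (j r : ZMod n) : k := qpow q r * (qpow q j + qpow q (-j))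

/-- `j = ± (i + m) / 2` and `r = (i - m) / 2` modulo `n`, for odd `n`. -/
def Halves {n : ℕ} (i m j r : ZMod n) : Prop :=
  (2 * j = i + m ∨ 2 * j = -(i + m)) ∧ 2 * r = i - m

end Simple

end DAlg

end

noncomputable section

/-! ## Additivity of composition multiplicities -/

/-! The McKay matrix is found from one exact sequence. Call a module with basis `v_0, v_1, …`, on
which `a` shifts, `b` and `c` are diagonal and `d` lowers, a chain of highest weight `(s, L)`. Then
`V(ℓ, s) ⊗ V(2, 0)` contains the chain of highest weight `(s, ℓ + 1)` generated by `v_0 ⊗ e_0`, and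
the quotient is the chain of highest weight `(s + 1, ℓ - 1)` (`compMult_tensor_chain`). For `ℓ < n`
these are `V(ℓ + 1, s)` and `V(ℓ - 1, s + 1)`, the latter zero if `ℓ = 1`. For `ℓ = n` both have
length `n`, and each has the composition factors `V(n - 1, s + 1)` and `V(1, s)`. Additivity of
multiplicities (`compMult_of_exact`) and the simplicity and pairwise non-isomorphism of the `V(ℓ,
s)` then give every row of the matrix.

An eigenvector is therefore a solution of a recursion in `ℓ`, coupled to the shift `s ↦ s + 1` and
closed by one equation at `ℓ = n` (`mcKay_mulVec_eq_smul_iff`). A Fourier transform in `s` with the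
characters `q ^ (2 r s)` (all characters of `ZMod n`, as `n` is odd) decouples it: in mode `r` the
recursion is that of the Chebyshev polynomials at `μ / q ^ r`. Writing `μ / q ^ r = z + z⁻¹`, the
closing equation becomes `(z ^ n - 1) ^ 2 = 0` (`chebU_last_iff`), so `z = q ^ j` and `μ = q ^ (r +
j) + q ^ (r - j)`.

A sum of two roots of unity of odd order determines the two roots (`eq_or_eq_of_qpow_add`), so `μ`
determines `r`. Hence only one mode of an eigenvector is nonzero, and the eigenvector is a multiple
of some `v_{j,r}` (`exists_eq_smul_chebVec`).

On the other side, `b ^ i c ^ k` is diagonal on `V(ℓ, s)`, and its trace is a geometric sum that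
equals the entry of `v_{j,r}` for `i = j + r`, `k = j - r`. The eigenvalue `q ^ i + q ^ (-k)`
determines the unordered pair `{i, -k}`, and so does the trace vector; the count is the number of
such pairs. -/

lemma Nat.card_subtype_fin_succ {m : ℕ} (P : Fin (m + 1) → Prop) [Decidable (P (Fin.last m))] :
    Nat.card {t // P t} =
      Nat.card {t : Fin m // P t.castSucc} + if P (Fin.last m) then 1 else 0 := by
  classical
  simp only [Nat.card_eq_fintype_card, Fintype.card_subtype, Finset.card_filter]
  rw [Fin.sum_univ_castSucc]
  congr

section CompositionMultiplicity

variable {A U S : Type*} [Ring A] [AddCommGroup U] [Module A U] [AddCommGroup S] [Module A S]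

/-- Mapping a pair of submodules along an injective map does not change their quotient. -/
def Submodule.quotientComapMapEquiv {V : Type*} [AddCommGroup V] [Module A V] (f : U →ₗ[A] V)
    (hf : Function.Injective f) (M N : Submodule A U) :
    (N ⧸ M.comap N.subtype) ≃ₗ[A]
      (N.map f ⧸ (M.map f).comap (N.map f).subtype) :=
  Submodule.Quotient.equiv _ _ (Submodule.equivMapOfInjective f hf N) (by
    ext ⟨y, hy⟩
    obtain ⟨x, hx, rfl⟩ := hy
    simp only [Submodule.mem_map, Submodule.mem_comap, Submodule.subtype_apply]
    constructor
    · rintro ⟨z, hz, h⟩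
      exact ⟨z, hz, congrArg Subtype.val h⟩
    · rintro ⟨z, hz, h⟩
      obtain rfl := hf h
      exact ⟨⟨z, hx⟩, hz, rfl⟩)

/-- Covering means that the quotient is simple, and an injective map preserves the quotient.
Surjectivity is not needed, so the lemma also transports a series of a submodule into the ambient
module. -/
lemma Submodule.map_covBy_map {V : Type*} [AddCommGroup V] [Module A V] (f : U →ₗ[A] V)
    (hf : Function.Injective f) {M N : Submodule A U} (h : M ⋖ N) : M.map f ⋖ N.map f := by
  have hs := (covBy_iff_quot_is_simple h.le).mp h
  refine (covBy_iff_quot_is_simple (Submodule.map_mono h.le)).mpr ?_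
  exact IsSimpleModule.congr (Submodule.quotientComapMapEquiv f hf M N).symm

lemma compMult_congr_left {V : Type*} [AddCommGroup V] [Module A V] (e : U ≃ₗ[A] V)
    (hU : IsFiniteLength A U) : compMult A U S = compMult A V S := by
  obtain ⟨s, h0, h1⟩ := isFiniteLength_iff_exists_compositionSeries.mp hU
  have hf : Function.Injective (e : U →ₗ[A] V) := e.injective
  let s' : CompositionSeries (Submodule A V) :=
    { length := s.length
      toFun := fun i => (s i).map (e : U →ₗ[A] V)
      step := fun i => Submodule.map_covBy_map _ hf (s.step i) }
  have h0' : s'.head = ⊥ := by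
    change Submodule.map _ s.head = ⊥
    rw [h0, Submodule.map_bot]
  have h1' : s'.last = ⊤ := by
    change Submodule.map _ s.last = ⊤
    rw [h1, Submodule.map_top, LinearEquiv.range]
  rw [compMult_eq A U S s h0 h1, compMult_eq A V S s' h0' h1']
  refine Nat.card_congr (Equiv.subtypeEquivRight fun t => ?_)
  have e' := Submodule.quotientComapMapEquiv (e : U →ₗ[A] V) hf (s t.castSucc) (s t.succ)
  exact ⟨fun ⟨g⟩ => ⟨e'.symm.trans g⟩, fun ⟨g⟩ => ⟨e'.trans g⟩⟩

lemma compMult_eq_zero_of_subsingleton [Subsingleton U] : compMult A U S = 0 := by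
  let s : CompositionSeries (Submodule A U) := RelSeries.singleton _ ⊥
  rw [compMult_eq A U S s rfl (Subsingleton.elim _ _), factorCount]
  have : IsEmpty (Fin s.length) := inferInstanceAs (IsEmpty (Fin 0))
  simp

open Classical in
/-- The multiplicity in a module with a maximal submodule. -/
lemma compMult_of_simple_quotient (N : Submodule A U) [hN : IsSimpleModule A (U ⧸ N)]
    (hfin : IsFiniteLength A N) : compMult A U S =
      compMult A N S + if Nonempty ((U ⧸ N) ≃ₗ[A] S) then 1 else 0 := by
  obtain ⟨s, h0, h1⟩ := isFiniteLength_iff_exists_compositionSeries.mp hfin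
  have hcov : N ⋖ ⊤ := covBy_top_iff.mpr (isSimpleModule_iff_isCoatom.mp hN)
  have htop : Submodule.map N.subtype s.last = N := by rw [h1, Submodule.map_subtype_top]
  -- A series of `N`, pushed into `U` and extended by `⊤`, is a series of `U`; its last factor is `U
  -- ⧸ N`.
  let g : Fin (s.length + 1 + 1) → Submodule A U :=
    Fin.snoc (α := fun _ => Submodule A U) (fun i => (s i).map N.subtype) ⊤
  have gc : ∀ i : Fin (s.length + 1), g i.castSucc = (s i).map N.subtype := fun i =>
    Fin.snoc_castSucc (α := fun _ => Submodule A U) _ _ _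
  have gl : g (Fin.last _) = ⊤ := Fin.snoc_last (α := fun _ => Submodule A U) _ _
  have gll : g (Fin.last s.length).castSucc = N := (gc _).trans htop
  let s' : CompositionSeries (Submodule A U) :=
    { length := s.length + 1
      toFun := g
      step := by
        intro i
        change g i.castSucc ⋖ g i.succ
        induction i using Fin.lastCases with
        | last => rw [Fin.succ_last, gl, gll]; exact hcov
        | cast i =>
          rw [← Fin.castSucc_succ, gc, gc]
          exact Submodule.map_covBy_map _ N.injective_subtype (s.step i) }
  have h0' : s'.head = ⊥ := by
    change g (Fin.castSucc 0) = ⊥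
    rw [gc, show s 0 = ⊥ from h0, Submodule.map_bot]
  rw [compMult_eq A U S s' h0' gl, compMult_eq A N S s h0 h1, factorCount, factorCount]
  change Nat.card {t : Fin (s.length + 1) //
    Nonempty ((g t.succ ⧸ (g t.castSucc).comap (g t.succ).subtype) ≃ₗ[A] S)} = _
  rw [Nat.card_subtype_fin_succ]
  congr 1
  · refine Nat.card_congr (Equiv.subtypeEquivRight fun t => ?_)
    rw [← Fin.castSucc_succ, gc, gc]
    have e' := Submodule.quotientComapMapEquiv N.subtype N.injective_subtype
      (s t.castSucc) (s t.succ)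
    exact ⟨fun ⟨f⟩ => ⟨e'.trans f⟩, fun ⟨f⟩ => ⟨e'.symm.trans f⟩⟩
  · have e' : ((⊤ : Submodule A U) ⧸ N.comap (⊤ : Submodule A U).subtype) ≃ₗ[A] (U ⧸ N) :=
      Submodule.Quotient.equiv _ _ Submodule.topEquiv (by ext x; simp)
    rw [Fin.succ_last, gl, gll]
    refine if_congr ?_ rfl rfl
    exact ⟨fun ⟨f⟩ => ⟨e'.symm.trans f⟩, fun ⟨f⟩ => ⟨e'.trans f⟩⟩

lemma IsFiniteLength.of_isSimpleModule [IsSimpleModule A U] : IsFiniteLength A U :=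
  isFiniteLength_iff_isNoetherian_isArtinian.mpr ⟨inferInstance, inferInstance⟩

open Classical in
lemma compMult_of_isSimpleModule [IsSimpleModule A U] :
    compMult A U S = if Nonempty (U ≃ₗ[A] S) then 1 else 0 := by
  have e : (U ⧸ (⊥ : Submodule A U)) ≃ₗ[A] U := Submodule.quotEquivOfEqBot ⊥ rfl
  have : IsSimpleModule A (U ⧸ (⊥ : Submodule A U)) := IsSimpleModule.congr e
  rw [compMult_of_simple_quotient (⊥ : Submodule A U) .of_subsingleton,
    compMult_eq_zero_of_subsingleton, zero_add]
  refine if_congr ?_ rfl rfl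
  exact ⟨fun ⟨f⟩ => ⟨e.symm.trans f⟩, fun ⟨f⟩ => ⟨e.trans f⟩⟩

lemma IsFiniteLength.of_ker {Q : Type*} [AddCommGroup Q] [Module A Q] (π : U →ₗ[A] Q)
    (hQ : IsFiniteLength A Q) (hker : IsFiniteLength A (LinearMap.ker π)) :
    IsFiniteLength A U := by
  rw [isFiniteLength_iff_isNoetherian_isArtinian] at *
  obtain ⟨_, _⟩ := hQ
  obtain ⟨_, _⟩ := hker
  exact ⟨isNoetherian_of_range_eq_ker (LinearMap.ker π).subtype π (by simp),
    isArtinian_of_range_eq_ker (LinearMap.ker π).subtype π (by simp)⟩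

/-- Induction on the finite length of `Q`, with `U` varying. If `Q ⧸ R` is simple, then the preimage
of `R` in `U` has the same simple quotient, and `π` restricts to a surjection of that preimage onto
`R` with the same kernel. Both sides thus lose the same simple factor. -/
lemma compMult_eq_ker_add {Q : Type*} [AddCommGroup Q] [Module A Q] (hQ : IsFiniteLength A Q) :
    ∀ {U : Type*} [AddCommGroup U] [Module A U] (π : U →ₗ[A] Q), Function.Surjective π →
      IsFiniteLength A (LinearMap.ker π) →
      compMult A U S = compMult A (LinearMap.ker π) S + compMult A Q S := by
  induction hQ with
  | @of_subsingleton Q _ _ _ =>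
    intro U _ _ π _ hker
    have e : LinearMap.ker π ≃ₗ[A] U := (LinearEquiv.ofEq _ _ (LinearMap.ker_eq_top.mpr
      (LinearMap.ext fun _ => Subsingleton.elim _ _))).trans Submodule.topEquiv
    rw [compMult_eq_zero_of_subsingleton (U := Q), add_zero, compMult_congr_left e hker]
  | @of_simple_quotient Q _ _ R _ hR ih =>
    intro U _ _ π hπ hker
    classical
    let π' : R.comap π →ₗ[A] R := π.restrict fun _ h => h
    have hπ' : Function.Surjective π' := by
      rintro ⟨y, hy⟩
      obtain ⟨x, rfl⟩ := hπ y
      exact ⟨⟨x, hy⟩, rfl⟩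
    let e : LinearMap.ker π ≃ₗ[A] LinearMap.ker π' :=
      { toFun := fun x => ⟨⟨x, by
            rw [Submodule.mem_comap, LinearMap.mem_ker.mp x.2]; exact R.zero_mem⟩,
          Subtype.ext x.2⟩
        map_add' := fun _ _ => rfl
        map_smul' := fun _ _ => rfl
        invFun := fun x => ⟨x.1, congrArg Subtype.val x.2⟩
        left_inv := fun _ => rfl
        right_inv := fun _ => rfl }
    let e' : (U ⧸ R.comap π) ≃ₗ[A] (Q ⧸ R) :=
      LinearEquiv.ofBijective (Submodule.mapQ _ _ π le_rfl) (by
        constructor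
        · rw [← LinearMap.ker_eq_bot, Submodule.ker_mapQ, Submodule.mkQ_map_self]
        · intro y
          obtain ⟨y, rfl⟩ := Submodule.mkQ_surjective _ y
          obtain ⟨x, rfl⟩ := hπ y
          exact ⟨Submodule.Quotient.mk x, rfl⟩)
    have hs : IsSimpleModule A (U ⧸ R.comap π) := IsSimpleModule.congr e'
    have hker' := e.isFiniteLength hker
    rw [compMult_of_simple_quotient (R.comap π) (IsFiniteLength.of_ker π' ‹_› hker'),
      compMult_of_simple_quotient R ‹_›, ih π' hπ' hker', compMult_congr_left e hker, add_assoc]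
    congr 2
    refine if_congr ?_ rfl rfl
    exact ⟨fun ⟨f⟩ => ⟨e'.symm.trans f⟩, fun ⟨f⟩ => ⟨e'.trans f⟩⟩

/-- Composition multiplicities are additive in short exact sequences. -/
lemma compMult_of_exact {N Q : Type*} [AddCommGroup N] [Module A N] [AddCommGroup Q] [Module A Q]
    (hN : IsFiniteLength A N) (hQ : IsFiniteLength A Q) (i : N →ₗ[A] U) (π : U →ₗ[A] Q)
    (hi : Function.Injective i) (hπ : Function.Surjective π)
    (hex : LinearMap.range i = LinearMap.ker π) :
    IsFiniteLength A U ∧ compMult A U S = compMult A N S + compMult A Q S := by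
  have e : N ≃ₗ[A] LinearMap.ker π :=
    (LinearEquiv.ofInjective i hi).trans (LinearEquiv.ofEq _ _ hex)
  have hker := e.isFiniteLength hN
  exact ⟨.of_ker π hQ hker, by rw [compMult_eq_ker_add hQ π hπ hker, compMult_congr_left e hN]⟩

end CompositionMultiplicity

/-! ## Intertwining maps -/

section Intertwining

variable {k A V W : Type*} [Field k] [AddCommGroup V] [Module k V] [AddCommGroup W] [Module k W]
  [Ring A] [Algebra k A]

/-- A linear map commuting with two representations, as a map of modules. -/
def RepMod.hom {ρ : A →ₐ[k] Module.End k V} {σ : A →ₐ[k] Module.End k W} (f : V →ₗ[k] W)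
    (h : ∀ x v, f (ρ x v) = σ x (f v)) : RepMod ρ →ₗ[A] RepMod σ where
  toFun := f
  map_add' := f.map_add
  map_smul' := h

/-- One inclusion and a dimension count replace a direct proof of exactness in the middle. -/
lemma LinearMap.range_eq_ker_of_finrank {Q : Type*} [AddCommGroup Q] [Module k Q]
    [FiniteDimensional k V] [FiniteDimensional k W] {i : V →ₗ[k] W} {π : W →ₗ[k] Q}
    (hi : Function.Injective i) (hπ : Function.Surjective π) (h0 : π ∘ₗ i = 0)
    (hdim : Module.finrank k W = Module.finrank k V + Module.finrank k Q) :
    LinearMap.range i = LinearMap.ker π := by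
  refine Submodule.eq_of_le_of_finrank_eq (LinearMap.range_le_ker_iff.mpr h0) ?_
  have h1 := LinearMap.finrank_range_add_finrank_ker π
  rw [LinearMap.range_eq_top.mpr hπ, finrank_top] at h1
  rw [LinearMap.finrank_range_of_inj hi]
  omega

/-- Multiplicities for an exact sequence of representations. -/
lemma compMult_repMod_of_exact {Q : Type*} [AddCommGroup Q] [Module k Q]
    [FiniteDimensional k V] [FiniteDimensional k W]
    {ρ : A →ₐ[k] Module.End k V} {σ : A →ₐ[k] Module.End k W} {τ : A →ₐ[k] Module.End k Q}
    (hV : IsFiniteLength A (RepMod ρ)) (hQ : IsFiniteLength A (RepMod τ))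
    (i : V →ₗ[k] W) (π : W →ₗ[k] Q)
    (hi : Function.Injective i) (hπ : Function.Surjective π) (h0 : π ∘ₗ i = 0)
    (hdim : Module.finrank k W = Module.finrank k V + Module.finrank k Q)
    (hiA : ∀ x v, i (ρ x v) = σ x (i v)) (hπA : ∀ x v, π (σ x v) = τ x (π v))
    (S : Type*) [AddCommGroup S] [Module A S] :
    IsFiniteLength A (RepMod σ) ∧ compMult A (RepMod σ) S =
      compMult A (RepMod ρ) S + compMult A (RepMod τ) S := by
  refine compMult_of_exact hV hQ (RepMod.hom i hiA) (RepMod.hom π hπA) hi hπ ?_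
  have h := LinearMap.range_eq_ker_of_finrank hi hπ h0 hdim
  ext x
  exact SetLike.ext_iff.mp h x

end Intertwining

namespace DAlg

section Intertwining

variable {k V W : Type*} [Field k] [AddCommGroup V] [Module k V] [AddCommGroup W] [Module k W]
  {n : ℕ} {q : k}

/-- The elements whose two actions are intertwined by `f` form a subalgebra, so the four generators
suffice. -/
lemma intertwines {ρ : DAlg n q →ₐ[k] Module.End k V} {σ : DAlg n q →ₐ[k] Module.End k W}
    (f : V →ₗ[k] W) (ha : f ∘ₗ ρ (a n q) = σ (a n q) ∘ₗ f) (hb : f ∘ₗ ρ (b n q) = σ (b n q) ∘ₗ f)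
    (hc : f ∘ₗ ρ (c n q) = σ (c n q) ∘ₗ f) (hd : f ∘ₗ ρ (d n q) = σ (d n q) ∘ₗ f)
    (x : DAlg n q) (v : V) : f (ρ x v) = σ x (f v) := by
  induction x using DAlg.induction generalizing v with
  | h1 r => simp [AlgHom.commutes, Module.algebraMap_end_apply]
  | ha => exact LinearMap.congr_fun ha v
  | hb => exact LinearMap.congr_fun hb v
  | hc => exact LinearMap.congr_fun hc v
  | hd => exact LinearMap.congr_fun hd v
  | hmul x y hx hy => simp [hx, hy]
  | hadd x y hx hy => simp [hx, hy]

variable [NeZero n] [Fact (IsPrimitiveRoot q n)]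
  (ρ : DAlg n q →ₐ[k] Module.End k V) (σ : DAlg n q →ₐ[k] Module.End k W) (v : V) (w : W)

lemma tensorRep_a : tensorRep ρ σ (a n q) (v ⊗ₜ w) =
    ρ (a n q) v ⊗ₜ σ (b n q) w + v ⊗ₜ σ (a n q) w := by
  have h : Bialgebra.comulAlgHom k (DAlg n q) (a n q) =
      a n q ⊗ₜ[k] b n q + 1 ⊗ₜ[k] a n q := lift_a comul_relations
  simp [tensorRep, h, Module.endTensorEndAlgHom_apply]

lemma tensorRep_b : tensorRep ρ σ (b n q) (v ⊗ₜ w) = ρ (b n q) v ⊗ₜ σ (b n q) w := by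
  have h : Bialgebra.comulAlgHom k (DAlg n q) (b n q) = b n q ⊗ₜ[k] b n q := lift_b comul_relations
  simp [tensorRep, h, Module.endTensorEndAlgHom_apply]

lemma tensorRep_c : tensorRep ρ σ (c n q) (v ⊗ₜ w) = ρ (c n q) v ⊗ₜ σ (c n q) w := by
  have h : Bialgebra.comulAlgHom k (DAlg n q) (c n q) = c n q ⊗ₜ[k] c n q := lift_c comul_relations
  simp [tensorRep, h, Module.endTensorEndAlgHom_apply]

lemma tensorRep_d : tensorRep ρ σ (d n q) (v ⊗ₜ w) =
    ρ (d n q) v ⊗ₜ σ (c n q) w + v ⊗ₜ σ (d n q) w := by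
  have h : Bialgebra.comulAlgHom k (DAlg n q) (d n q) =
      d n q ⊗ₜ[k] c n q + 1 ⊗ₜ[k] d n q := lift_d comul_relations
  simp [tensorRep, h, Module.endTensorEndAlgHom_apply]

end Intertwining

/-! ## Linear maps given on the standard basis -/

section StdBasis

variable {k M : Type*} [Field k] [AddCommGroup M] [Module k M]

lemma stdVec_val {l : ℕ} (u : Fin l) : stdVec k l u = Pi.basisFun k (Fin l) u := by
  ext u
  simp [stdVec, Pi.single_apply, Fin.ext_iff]

lemma hom_ext_stdVec {l : ℕ} {f g : (Fin l → k) →ₗ[k] M}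
    (h : ∀ t < l, f (stdVec k l t) = g (stdVec k l t)) : f = g := by
  refine (Pi.basisFun k (Fin l)).ext fun u => ?_
  rw [← stdVec_val]
  exact h u u.2

/-- The linear map with prescribed values on the standard basis of `k ^ ℓ`. -/
def stdMap (k : Type*) [Field k] [Module k M] (l : ℕ) (f : ℕ → M) : (Fin l → k) →ₗ[k] M :=
  (Pi.basisFun k (Fin l)).constr k fun u => f u

lemma stdMap_stdVec (l : ℕ) (f : ℕ → M) {t : ℕ} (h : t < l) :
    stdMap k l f (stdVec k l t) = f t := by
  rw [show stdVec k l t = stdVec k l (⟨t, h⟩ : Fin l) from rfl, stdVec_val, stdMap,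
    Module.Basis.constr_basis]

/-- Since `stdVec k l t` vanishes for `l ≤ t`, a formula that vanishes there too holds for every
`t`. Maps between chains can then be computed without separating the end of the chain. -/
lemma stdMap_stdVec_of_zero {l : ℕ} {f : ℕ → M} (hf : ∀ t, l ≤ t → f t = 0) (t : ℕ) :
    stdMap k l f (stdVec k l t) = f t := by
  rcases Nat.lt_or_ge t l with h | h
  · exact stdMap_stdVec l f h
  · rw [stdVec_eq_zero h, map_zero, hf t h]

lemma leftInverse_of_stdVec {l : ℕ} {f : M →ₗ[k] (Fin l → k)} {g : (Fin l → k) →ₗ[k] M}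
    (h : ∀ t < l, f (g (stdVec k l t)) = stdVec k l t) : Function.LeftInverse f g :=
  LinearMap.congr_fun (f := f ∘ₗ g) (g := LinearMap.id) (hom_ext_stdVec h)

lemma exists_stdMap {l : ℕ} {f : ℕ → M} (hf : ∀ t, l ≤ t → f t = 0) :
    ∃ g : (Fin l → k) →ₗ[k] M, ∀ t, g (stdVec k l t) = f t :=
  ⟨stdMap k l f, stdMap_stdVec_of_zero hf⟩

/-- The linear map on `V ⊗ k ^ 2` with prescribed restrictions to `V ⊗ e₀` and `V ⊗ e₁`. -/
def pairMap {V : Type*} [AddCommGroup V] [Module k V] (P Q : V →ₗ[k] M) :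
    V ⊗[k] (Fin 2 → k) →ₗ[k] M :=
  TensorProduct.lift (LinearMap.mk₂ k (fun v w => w 0 • P v + w 1 • Q v)
    (fun _ _ _ => by simp only [map_add, smul_add]; abel)
    (fun r v w => by simp only [map_smul, smul_add, smul_comm r])
    (fun _ _ _ => by simp only [Pi.add_apply, add_smul]; abel)
    (fun _ _ _ => by simp only [Pi.smul_apply, smul_eq_mul, mul_smul, smul_add]))

variable {V : Type*} [AddCommGroup V] [Module k V] (P Q : V →ₗ[k] M) (v : V)

@[simp] lemma pairMap_zero : pairMap P Q (v ⊗ₜ stdVec k 2 0) = P v := by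
  simp [pairMap, stdVec]

@[simp] lemma pairMap_one : pairMap P Q (v ⊗ₜ stdVec k 2 1) = Q v := by
  simp [pairMap, stdVec]

lemma tensor_hom_ext {l : ℕ} {f g : (Fin l → k) ⊗[k] (Fin 2 → k) →ₗ[k] M}
    (h0 : ∀ t < l, f (stdVec k l t ⊗ₜ stdVec k 2 0) = g (stdVec k l t ⊗ₜ stdVec k 2 0))
    (h1 : ∀ t < l, f (stdVec k l t ⊗ₜ stdVec k 2 1) = g (stdVec k l t ⊗ₜ stdVec k 2 1)) :
    f = g := by
  refine TensorProduct.ext (hom_ext_stdVec fun t ht => hom_ext_stdVec fun u hu => ?_)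
  interval_cases u
  · exact h0 t ht
  · exact h1 t ht

end StdBasis

/-! ## Powers of `q` -/

section Qpow

variable {k : Type*} [Field k] {n : ℕ} {q : k}

lemma qpow_zero : qpow q (0 : ZMod n) = 1 := by simp [qpow]

variable [NeZero n]

lemma qpow_natCast (hq : IsPrimitiveRoot q n) (t : ℕ) : qpow q (t : ZMod n) = q ^ t := by
  simpa using qpow_intCast hq t

lemma qpow_ne_zero (hq : IsPrimitiveRoot q n) (x : ZMod n) : qpow q x ≠ 0 :=
  pow_ne_zero _ (hq.ne_zero (NeZero.ne n))

lemma qpow_mul_qpow_neg (hq : IsPrimitiveRoot q n) (x : ZMod n) :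
    qpow q x * qpow q (-x) = 1 := by
  rw [← qpow_add hq, add_neg_cancel, qpow_zero]

lemma qpow_neg (hq : IsPrimitiveRoot q n) (x : ZMod n) : qpow q (-x) = (qpow q x)⁻¹ :=
  eq_inv_of_mul_eq_one_right (qpow_mul_qpow_neg hq x)

lemma qpow_sub (hq : IsPrimitiveRoot q n) (x y : ZMod n) :
    qpow q (x - y) = qpow q x / qpow q y := by
  rw [sub_eq_add_neg, qpow_add hq, qpow_neg hq, div_eq_mul_inv]

lemma qpow_natCast_mul (hq : IsPrimitiveRoot q n) (t : ℕ) (x : ZMod n) :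
    qpow q ((t : ZMod n) * x) = qpow q x ^ t := by
  induction t with
  | zero => simp [qpow_zero]
  | succ t ih => rw [Nat.cast_succ, add_one_mul, qpow_add hq, ih, pow_succ]

lemma qpow_injective (hq : IsPrimitiveRoot q n) :
    Function.Injective (qpow q : ZMod n → k) := fun x y h =>
  ZMod.val_injective n (hq.pow_inj (ZMod.val_lt x) (ZMod.val_lt y) h)

lemma qpow_eq_one_iff (hq : IsPrimitiveRoot q n) (x : ZMod n) : qpow q x = 1 ↔ x = 0 := by
  rw [← qpow_zero (q := q) (n := n), (qpow_injective hq).eq_iff]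

end Qpow

/-! ## Highest weight modules on a chain of vectors -/

section Chain

variable {k : Type*} [Field k] {n : ℕ} {q : k}

/-- The coefficient of `d` on the `t`th vector of a chain of highest weight `(s, L)`. -/
def chainCoeff (q : k) (L : ZMod n) (t : ℕ) : k :=
  (q ^ t - 1) * (1 - qpow q ((t : ZMod n) - L)) / (q - 1)

/-- The action of `c` on a chain. -/
def chainC (q : k) (N : ℕ) (L s : ZMod n) : Module.End k (Fin N → k) :=
  stdMap k N fun t => qpow q ((t : ZMod n) + 1 - (s + L)) • stdVec k N t

/-- The action of `d` on a chain. -/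
def chainD (q : k) (N : ℕ) (L : ZMod n) : Module.End k (Fin N → k) :=
  stdMap k N fun t => chainCoeff q L t • stdVec k N (t - 1)

lemma chainCoeff_zero (L : ZMod n) : chainCoeff q L 0 = 0 := by simp [chainCoeff]

lemma chainC_stdVec (N : ℕ) (L s : ZMod n) (t : ℕ) : chainC q N L s (stdVec k N t) =
    qpow q ((t : ZMod n) + 1 - (s + L)) • stdVec k N t :=
  stdMap_stdVec_of_zero (fun t ht => by rw [stdVec_eq_zero ht, smul_zero]) t

/-- The hypothesis makes the formula for `d` consistent with the vanishing of the `N`th vector. At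
`t = 0` the truncated `t - 1` is harmless, because the coefficient is zero. -/
lemma chainD_stdVec {N : ℕ} {L : ZMod n} (hL : chainCoeff q L N = 0) (t : ℕ) :
    chainD q N L (stdVec k N t) = chainCoeff q L t • stdVec k N (t - 1) := by
  refine stdMap_stdVec_of_zero (f := fun t => chainCoeff q L t • stdVec k N (t - 1))
    (fun t ht => ?_) t
  rcases ht.eq_or_lt with rfl | ht
  · rw [hL, zero_smul]
  · rw [stdVec_eq_zero (by omega), smul_zero]

lemma chainD_pow {N : ℕ} {L : ZMod n} (hL : chainCoeff q L N = 0) (m t : ℕ) (h : t < m) :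
    (chainD q N L ^ m) (stdVec k N t) = 0 := by
  induction m generalizing t with
  | zero => omega
  | succ m ih =>
    rw [pow_succ, Module.End.mul_apply, chainD_stdVec hL, map_smul]
    cases t with
    | zero => rw [chainCoeff_zero, zero_smul]
    | succ t => rw [Nat.add_sub_cancel, ih t (by omega), smul_zero]

lemma opB_stdVec_add (N : ℕ) (s : ZMod n) (t : ℕ) :
    opB q N s (stdVec k N t) = qpow q (s + (t : ZMod n)) • stdVec k N t := by
  rw [opB_stdVec]
  congr 2
  push_cast
  ring

/-- There are two ways for a chain to stop: the second factor of the coefficient vanishes at `t =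
L`, which gives `V(ℓ, s)`, and the first factor vanishes at `t = n` for every `L`
(`chainCoeff_period`). -/
lemma chainCoeff_self (l : ℕ) : chainCoeff q (l : ZMod n) l = 0 := by
  simp [chainCoeff, qpow_zero]

lemma chainCoeff_period (hq : IsPrimitiveRoot q n) (L : ZMod n) : chainCoeff q L n = 0 := by
  simp [chainCoeff, hq.pow_eq_one]

variable [NeZero n]

lemma chainCoeff_natCast (hq : IsPrimitiveRoot q n) (l t : ℕ) :
    chainCoeff q (l : ZMod n) t = alpha q l t := by
  rw [chainCoeff, alpha, ← qpow_intCast hq]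
  push_cast
  rfl

/-- This is the relation `d a - q a d = 1 - b c` on the `t`th vector; the last two powers of `q` are
the eigenvalues of `b` and `c`. -/
lemma chainCoeff_succ (hq : IsPrimitiveRoot q n) (hq1 : q ≠ 1) (L s : ZMod n) (t : ℕ) :
    chainCoeff q L (t + 1) = q * chainCoeff q L t +
      (1 - qpow q (s + (t : ZMod n)) * qpow q ((t : ZMod n) + 1 - (s + L))) := by
  have h2 : q - 1 ≠ 0 := sub_ne_zero.mpr hq1
  have e1 : qpow q (((t + 1 : ℕ) : ZMod n) - L) = q * qpow q ((t : ZMod n) - L) := by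
    rw [Nat.cast_succ, add_sub_right_comm, qpow_add hq, qpow_one hq, mul_comm]
  have e2 : qpow q (s + (t : ZMod n)) * qpow q ((t : ZMod n) + 1 - (s + L)) =
      q * (q ^ t * qpow q ((t : ZMod n) - L)) := by
    have h : s + (t : ZMod n) + ((t : ZMod n) + 1 - (s + L)) = 1 + (t + (t - L)) := by ring
    rw [← qpow_add hq, h, qpow_add hq, qpow_add hq, qpow_one hq, qpow_natCast hq]
  rw [chainCoeff, chainCoeff, e1, e2]
  field_simp
  ring

/-- The operators of `a` and `b` are those of `V(N, s)`, so the relations between them are already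
known; only those with `c` or `d` involve the weight `L`. -/
lemma chain_relations (hq : IsPrimitiveRoot q n) (hq1 : q ≠ 1) {N : ℕ} (hN : N ≤ n)
    {L : ZMod n} (s : ZMod n) (hL : chainCoeff q L N = 0) :
    DRelations n q (opA k N) (opB q N s) (chainC q N L s) (chainD q N L) where
  ba := (op_relations hq hN s).ba
  db := by
    refine end_ext fun t _ => ?_
    simp only [Module.End.mul_apply, LinearMap.smul_apply, opB_stdVec_add, chainD_stdVec hL,
      map_smul, smul_smul]
    cases t with
    | zero => simp [chainCoeff_zero]
    | succ t =>
      rw [Nat.cast_succ, Nat.add_sub_cancel, ← add_assoc, qpow_add hq _ 1, qpow_one hq]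
      congr 1
      ring
  ca := by
    refine end_ext fun t _ => ?_
    simp only [Module.End.mul_apply, LinearMap.smul_apply, opA_stdVec, chainC_stdVec, map_smul,
      smul_smul]
    rw [Nat.cast_succ, add_sub_right_comm, qpow_add hq _ 1, qpow_one hq, mul_comm]
  dc := by
    refine end_ext fun t _ => ?_
    simp only [Module.End.mul_apply, LinearMap.smul_apply, chainC_stdVec, chainD_stdVec hL,
      map_smul, smul_smul]
    cases t with
    | zero => simp [chainCoeff_zero]
    | succ t =>
      rw [Nat.cast_succ, Nat.add_sub_cancel, add_sub_right_comm, qpow_add hq _ 1, qpow_one hq]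
      congr 1
      ring
  bc := by
    refine end_ext fun t _ => ?_
    simp only [Module.End.mul_apply, opB_stdVec_add, chainC_stdVec, map_smul, smul_smul]
    rw [mul_comm]
  da := by
    refine end_ext fun t _ => ?_
    simp only [LinearMap.sub_apply, LinearMap.smul_apply, Module.End.mul_apply,
      Module.End.one_apply, opA_stdVec, opB_stdVec_add, chainC_stdVec, chainD_stdVec hL, map_smul,
      smul_smul]
    rw [chainCoeff_succ hq hq1 L s]
    cases t with
    | zero =>
      simp only [chainCoeff_zero, zero_add, mul_zero, zero_smul, sub_zero,
        sub_smul, one_smul]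
      rw [mul_comm]
    | succ t =>
      simp only [Nat.add_sub_cancel, add_smul, sub_smul, one_smul]
      rw [mul_comm (qpow q (_ - _))]
      abel
  an := (op_relations hq hN s).an
  dn := by
    refine end_ext fun t _ => ?_
    rw [chainD_pow hL n t (by omega), LinearMap.zero_apply]
  bn := (op_relations hq hN s).bn
  cn := by
    refine end_ext fun t _ => ?_
    have h : ∀ m : ℕ, (chainC q N L s ^ m) (stdVec k N t) =
        qpow q ((t : ZMod n) + 1 - (s + L)) ^ m • stdVec k N t := by
      intro m
      induction m with
      | zero => simp
      | succ m ih => rw [pow_succ', Module.End.mul_apply, ih, map_smul, chainC_stdVec, smul_smul,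
          pow_succ]
    rw [h, qpow_pow hq, one_smul, Module.End.one_apply]

variable [hq : Fact (IsPrimitiveRoot q n)]

/-- The module on a chain of `N` vectors, with highest weight `(s, L)`. -/
def chainRep (hq1 : q ≠ 1) (N : ℕ) (hN : N ≤ n) (L s : ZMod n) (hL : chainCoeff q L N = 0) :
    DAlg n q →ₐ[k] Module.End k (Fin N → k) :=
  lift (chain_relations hq.out hq1 hN s hL)

lemma simpleRep_eq_chainRep (hq1 : q ≠ 1) (l : ℕ) (hl : l ≤ n) (s : ZMod n) :
    simpleRep n q l hl s = chainRep hq1 l hl l s (chainCoeff_self l) := by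
  refine hom_ext ?_ ?_ ?_ ?_
  · rw [simpleRep, chainRep, lift_a, lift_a]
  · rw [simpleRep, chainRep, lift_b, lift_b]
  · rw [simpleRep, chainRep, lift_c, lift_c]
    refine end_ext fun t _ => ?_
    rw [opC_stdVec, chainC_stdVec, Nat.cast_succ]
  · rw [simpleRep, chainRep, lift_d, lift_d]
    refine end_ext fun t _ => ?_
    rw [chainD_stdVec (chainCoeff_self l)]
    cases t with
    | zero => rw [opD_zero, chainCoeff_zero, zero_smul]
    | succ t => rw [opD_succ, chainCoeff_natCast hq.out, Nat.add_sub_cancel]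

/-- A chain of full length `n` is an extension of two shorter chains. -/
lemma compMult_chainRep (hq1 : q ≠ 1) (M : ℕ) (hM : M ≤ n) (s : ZMod n)
    (h1 : IsFiniteLength (DAlg n q) (RepMod (simpleRep n q (n - M) (Nat.sub_le n M) (s + M))))
    (h2 : IsFiniteLength (DAlg n q) (RepMod (simpleRep n q M hM s)))
    (S : Type*) [AddCommGroup S] [Module (DAlg n q) S] :
    IsFiniteLength (DAlg n q)
      (RepMod (chainRep hq1 n le_rfl M s (chainCoeff_period hq.out (M : ZMod n)))) ∧
    compMult (DAlg n q)
        (RepMod (chainRep hq1 n le_rfl M s (chainCoeff_period hq.out (M : ZMod n)))) S =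
      compMult (DAlg n q) (RepMod (simpleRep n q (n - M) (Nat.sub_le n M) (s + M))) S +
      compMult (DAlg n q) (RepMod (simpleRep n q M hM s)) S := by
  rw [simpleRep_eq_chainRep hq1] at h1 h2 ⊢
  rw [simpleRep_eq_chainRep hq1]
  have hcast : ((n - M : ℕ) : ZMod n) = -M := by rw [Nat.cast_sub hM]; simp
  -- As `L = M`, the coefficient of `d` vanishes at `t = M`, so the vectors from index `M` on span a
  -- submodule. Its highest weight is `(s + M, -M)`, and `-M` is the residue of its length `n - M`.
  obtain ⟨i, hi⟩ : ∃ i : (Fin (n - M) → k) →ₗ[k] (Fin n → k),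
      ∀ t, i (stdVec k (n - M) t) = stdVec k n (t + M) :=
    exists_stdMap fun t ht => stdVec_eq_zero (by omega)
  obtain ⟨i', hi'⟩ : ∃ i' : (Fin n → k) →ₗ[k] (Fin (n - M) → k),
      ∀ t, i' (stdVec k n t) = if M ≤ t then stdVec k (n - M) (t - M) else 0 :=
    exists_stdMap fun t ht => by rw [if_pos (by omega), stdVec_eq_zero (by omega)]
  obtain ⟨p, hp⟩ : ∃ p : (Fin n → k) →ₗ[k] (Fin M → k),
      ∀ t, p (stdVec k n t) = stdVec k M t :=
    exists_stdMap fun t ht => stdVec_eq_zero (by omega)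
  refine compMult_repMod_of_exact h1 h2 i p ?_ ?_ ?_ ?_ ?_ ?_ S
  · refine Function.LeftInverse.injective (g := i') (leftInverse_of_stdVec fun t _ => ?_)
    rw [hi, hi', if_pos (by omega), Nat.add_sub_cancel]
  · refine Function.RightInverse.surjective (g := stdMap k M fun t => stdVec k n t)
      (leftInverse_of_stdVec fun t ht => ?_)
    rw [stdMap_stdVec _ _ ht, hp]
  · refine hom_ext_stdVec fun t _ => ?_
    rw [LinearMap.comp_apply, hi, hp, stdVec_eq_zero (by omega), LinearMap.zero_apply]
  · simp only [Module.finrank_fin_fun]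
    omega
  · refine intertwines _ ?_ ?_ ?_ ?_ <;> refine hom_ext_stdVec fun t _ => ?_ <;>
      simp only [LinearMap.comp_apply, chainRep, lift_a, lift_b, lift_c, lift_d, opA_stdVec,
        opB_stdVec_add, chainC_stdVec, chainD_stdVec (chainCoeff_self _),
        chainD_stdVec (chainCoeff_period hq.out _), hi, map_smul]
    · rw [add_right_comm]
    · congr 2
      push_cast
      ring
    · congr 2
      rw [hcast]
      push_cast
      ring
    · cases t with
      | zero => rw [chainCoeff_zero, zero_add, chainCoeff_self, zero_smul, zero_smul]
      | succ t =>
        rw [Nat.add_sub_cancel, Nat.add_right_comm t 1 M, Nat.add_sub_cancel]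
        congr 1
        -- The shift by `M` interchanges the two factors of the coefficient and changes both signs.
        rw [chainCoeff, chainCoeff, hcast, sub_neg_eq_add, ← Nat.cast_add,
          Nat.add_right_comm t M 1, Nat.cast_add (t + 1) M, add_sub_cancel_right,
          ← Nat.cast_add, qpow_natCast hq.out, qpow_natCast hq.out]
        ring
  · refine intertwines _ ?_ ?_ ?_ ?_ <;> refine hom_ext_stdVec fun t _ => ?_ <;>
      simp only [LinearMap.comp_apply, chainRep, lift_a, lift_b, lift_c, lift_d, opA_stdVec,
        opB_stdVec_add, chainC_stdVec, chainD_stdVec (chainCoeff_self _),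
        chainD_stdVec (chainCoeff_period hq.out _), hp, map_smul]

end Chain

section SimpleModules

variable {k : Type*} [Field k] {n : ℕ} {q : k} [NeZero n] [hq : Fact (IsPrimitiveRoot q n)]

/-! ## The simple modules -/

section Action

variable (l : ℕ) (hl : l ≤ n) (s : ZMod n) (t : ℕ)

lemma simpleRep_a : simpleRep n q l hl s (a n q) (stdVec k l t) = stdVec k l (t + 1) := by
  rw [simpleRep, lift_a, opA_stdVec]

lemma simpleRep_b : simpleRep n q l hl s (b n q) (stdVec k l t) =
    qpow q (s + (t : ZMod n)) • stdVec k l t := by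
  rw [simpleRep, lift_b, opB_stdVec_add]

lemma simpleRep_c : simpleRep n q l hl s (c n q) (stdVec k l t) =
    qpow q ((t : ZMod n) + 1 - (s + (l : ZMod n))) • stdVec k l t := by
  rw [simpleRep, lift_c, opC_stdVec, Nat.cast_succ]

lemma simpleRep_d : simpleRep n q l hl s (d n q) (stdVec k l t) =
    chainCoeff q (l : ZMod n) t • stdVec k l (t - 1) := by
  rw [simpleRep, lift_d]
  cases t with
  | zero => rw [opD_zero, chainCoeff_zero, zero_smul]
  | succ t => rw [opD_succ, chainCoeff_natCast hq.out, Nat.add_sub_cancel]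

end Action

/-- Neither `t` nor `t - l` is divisible by `n`. The case `l = n` is separate because `l` is then
zero modulo `n`. -/
lemma chainCoeff_ne_zero {l t : ℕ} (hl : l ≤ n) (h0 : 0 < t) (ht : t < l) :
    chainCoeff q (l : ZMod n) t ≠ 0 := by
  have hq' := hq.out
  have h1 : q ≠ 1 := hq'.ne_one (by omega)
  refine div_ne_zero (mul_ne_zero ?_ ?_) (sub_ne_zero.mpr h1)
  · exact sub_ne_zero.mpr (hq'.pow_ne_one_of_pos_of_lt (by omega) (by omega))
  · rw [sub_ne_zero, ne_comm, Ne, qpow_eq_one_iff hq', sub_eq_zero,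
      ZMod.natCast_eq_natCast_iff']
    rcases hl.eq_or_lt with rfl | hl
    · rw [Nat.mod_eq_of_lt ht, Nat.mod_self]
      omega
    · rw [Nat.mod_eq_of_lt hl, Nat.mod_eq_of_lt (by omega)]
      omega

lemma eq_sum_stdVec {l : ℕ} (v : Fin l → k) : v = ∑ u : Fin l, v u • stdVec k l u := by
  conv_lhs => rw [← (Pi.basisFun k (Fin l)).sum_repr v]
  simp [stdVec_val]

/-- Any nonzero vector generates the module: a power of `a` moves its first nonzero component to the
last basis vector and kills the others, and `d` then descends through the whole basis, since its
coefficients do not vanish below `l`. -/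
lemma isSimpleModule_simpleRep {l : ℕ} (h1 : 1 ≤ l) (hl : l ≤ n) (s : ZMod n) :
    IsSimpleModule (DAlg n q) (RepMod (simpleRep n q l hl s)) := by
  have : NeZero l := ⟨by omega⟩
  refine isSimpleModule_iff_toSpanSingleton_surjective.mpr
    ⟨inferInstanceAs (Nontrivial (Fin l → k)), fun (v : Fin l → k) hv => ?_⟩
  -- The cyclic module generated by `v`, seen as a subspace over `k`.
  let P : Submodule k (Fin l → k) :=
    LinearMap.range ((LinearMap.applyₗ v) ∘ₗ (simpleRep n q l hl s).toLinearMap)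
  have hP : ∀ x, ∀ w ∈ P, simpleRep n q l hl s x w ∈ P := by
    rintro x _ ⟨y, rfl⟩
    exact ⟨x * y, by simp⟩
  suffices h : ∀ w, w ∈ P from fun w => h w
  have hvP : v ∈ P := ⟨1, by simp⟩
  have hpow : ∀ m, ∀ w ∈ P, (opA k l ^ m) w ∈ P := by
    intro m w hw
    have h := hP (a n q ^ m) w hw
    rwa [map_pow, simpleRep, lift_a] at h
  have hlast : stdVec k l (l - 1) ∈ P := by
    have hne : ∃ t, ∃ h : t < l, v ⟨t, h⟩ ≠ 0 := by
      obtain ⟨u, hu⟩ := Function.ne_iff.mp hv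
      exact ⟨u, u.2, hu⟩
    classical
    obtain ⟨ht, h0⟩ := Nat.find_spec hne
    -- With `t` the least index of a nonzero coordinate, `a ^ (l - 1 - t)` leaves only the term of
    -- index `t`.
    have hmin : ∀ u : Fin l, (u : ℕ) < Nat.find hne → v u = 0 := fun u hu =>
      not_not.mp fun h => Nat.find_min hne hu ⟨u.2, h⟩
    set t := Nat.find hne
    have h := hpow (l - 1 - t) v hvP
    rw [eq_sum_stdVec v, map_sum, Finset.sum_eq_single ⟨t, ht⟩, map_smul, opA_pow] at h
    · rw [show t + (l - 1 - t) = l - 1 by omega] at h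
      exact (P.smul_mem_iff h0).mp h
    · intro u _ hu
      rw [map_smul, opA_pow]
      rcases Nat.lt_or_gt_of_ne (fun h => hu (Fin.ext h) : (u : ℕ) ≠ t) with h | h
      · rw [hmin u h, zero_smul]
      · rw [stdVec_eq_zero (by omega), smul_zero]
    · simp
  have hall : ∀ m, m ≤ l - 1 → stdVec k l (l - 1 - m) ∈ P := by
    intro m
    induction m with
    | zero => exact fun _ => hlast
    | succ m ih =>
      intro hm
      have h := hP (d n q) _ (ih (by omega))
      rw [simpleRep_d] at h
      exact (P.smul_mem_iff (chainCoeff_ne_zero hl (by omega) (by omega))).mp h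
  intro w
  rw [eq_sum_stdVec w]
  refine P.sum_mem fun u _ => P.smul_mem _ ?_
  have h := hall (l - 1 - u) (by omega)
  rwa [show l - 1 - (l - 1 - u) = (u : ℕ) by omega] at h

lemma isFiniteLength_simpleRep (l : ℕ) (hl : l ≤ n) (s : ZMod n) :
    IsFiniteLength (DAlg n q) (RepMod (simpleRep n q l hl s)) := by
  rcases Nat.eq_zero_or_pos l with rfl | h
  · have : Subsingleton (RepMod (simpleRep n q 0 hl s)) :=
      inferInstanceAs (Subsingleton (Fin 0 → k))
    exact .of_subsingleton
  · have := isSimpleModule_simpleRep (q := q) h hl s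
    exact .of_isSimpleModule

/-- The coefficients of `d` at the positive indices below `l` are nonzero, so the kernel of `d` is
the line of highest weight vectors. -/
lemma eq_smul_of_d_eq_zero {l : ℕ} (h1 : 1 ≤ l) (hl : l ≤ n) (s : ZMod n) {w : Fin l → k}
    (h : simpleRep n q l hl s (d n q) w = 0) : w = w ⟨0, h1⟩ • stdVec k l 0 := by
  have key : ∀ t (ht : t + 1 < l), simpleRep n q l hl s (d n q) w ⟨t, by omega⟩ =
      chainCoeff q (l : ZMod n) (t + 1) * w ⟨t + 1, ht⟩ := by
    intro t ht
    refine LinearMap.congr_fun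
      (f := LinearMap.proj (⟨t, by omega⟩ : Fin l) ∘ₗ simpleRep n q l hl s (d n q))
      (g := chainCoeff q (l : ZMod n) (t + 1) • LinearMap.proj (⟨t + 1, ht⟩ : Fin l))
      (hom_ext_stdVec fun u hu => ?_) w
    rw [LinearMap.comp_apply, simpleRep_d]
    rcases Nat.eq_zero_or_pos u with rfl | hu0
    · simp [chainCoeff_zero, stdVec]
    · obtain ⟨u, rfl⟩ : ∃ v, u = v + 1 := ⟨u - 1, by omega⟩
      by_cases htu : t = u <;> simp [stdVec, htu]
  ext ⟨t, ht⟩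
  cases t with
  | zero => simp [stdVec]
  | succ t =>
    have h2 := key t ht
    rw [h, Pi.zero_apply] at h2
    rw [(mul_eq_zero.mp h2.symm).resolve_left (chainCoeff_ne_zero hl (by omega) ht)]
    simp [stdVec]

/-- A map of modules over a `k`-algebra is linear over `k`. -/
def linearOfHom {A V W : Type*} [AddCommGroup V] [Module k V] [AddCommGroup W]
    [Module k W] [Ring A] [Algebra k A] {ρ : A →ₐ[k] Module.End k V} {σ : A →ₐ[k] Module.End k W}
    (f : RepMod ρ →ₗ[A] RepMod σ) : V →ₗ[k] W where
  toFun := f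
  map_add' := f.map_add
  map_smul' r v := by
    have h : f (ρ (algebraMap k A r) v) = σ (algebraMap k A r) (f v) :=
      f.map_smul (algebraMap k A r) v
    rw [AlgHom.commutes, AlgHom.commutes, Module.algebraMap_end_apply] at h
    exact h

/-- An isomorphism carries the kernel of `d` to the kernel of `d`, hence a highest weight vector to
a highest weight vector. The eigenvalue of `b` there gives `s`, and that of `c` then gives `ℓ`
modulo `n`, which is enough as `1 ≤ ℓ ≤ n`. -/
lemma eq_of_linearEquiv_simpleRep {l l' : ℕ} (h1 : 1 ≤ l) (hl : l ≤ n) (h1' : 1 ≤ l')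
    (hl' : l' ≤ n) (s s' : ZMod n)
    (e : RepMod (simpleRep n q l hl s) ≃ₗ[DAlg n q] RepMod (simpleRep n q l' hl' s')) :
    l = l' ∧ s = s' := by
  have hq' := hq.out
  let f : (Fin l → k) →ₗ[k] (Fin l' → k) := linearOfHom e.toLinearMap
  have hf : Function.Injective f := e.injective
  have fsmul : ∀ (x : DAlg n q) (v : Fin l → k),
      f (simpleRep n q l hl s x v) = simpleRep n q l' hl' s' x (f v) :=
    fun x v => e.map_smul x v
  obtain ⟨w, hw⟩ : ∃ w : Fin l' → k, w = f (stdVec k l 0) := ⟨_, rfl⟩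
  have hstd : stdVec k l 0 ≠ 0 := fun h => by
    have := congrFun h ⟨0, h1⟩
    simp [stdVec] at this
  have hw0 : w ≠ 0 := fun h => hstd (hf ((hw.symm.trans h).trans f.map_zero.symm))
  have hd := fsmul (d n q) (stdVec k l 0)
  rw [simpleRep_d, chainCoeff_zero, zero_smul, ← hw, map_zero] at hd
  obtain ⟨z, hz⟩ : ∃ z : k, w = z • stdVec k l' 0 := ⟨_, eq_smul_of_d_eq_zero h1' hl' s' hd.symm⟩
  have hb := fsmul (b n q) (stdVec k l 0)
  rw [simpleRep_b, map_smul, ← hw, hz, map_smul, simpleRep_b, smul_comm z, ← hz] at hb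
  have hc := fsmul (c n q) (stdVec k l 0)
  rw [simpleRep_c, map_smul, ← hw, hz, map_smul, simpleRep_c, smul_comm z, ← hz] at hc
  have hs := qpow_injective hq' (smul_left_injective k hw0 hb)
  have hl2 := qpow_injective hq' (smul_left_injective k hw0 hc)
  have hss : s = s' := by simpa using hs
  rw [hss] at hl2
  have hll : (l : ZMod n) = l' := by simpa using hl2
  refine ⟨?_, hss⟩
  have h := Nat.ModEq.dvd ((ZMod.natCast_eq_natCast_iff _ _ _).mp hll)
  by_contra hne
  have h2 := Int.le_of_dvd (b := |(l' : ℤ) - l|) (abs_pos.mpr (by omega)) ((dvd_abs _ _).mpr h)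
  rw [le_abs] at h2
  omega

open Classical in
lemma compMult_simpleRep {l l' : ℕ} (h1 : 1 ≤ l) (hl : l ≤ n) (h1' : 1 ≤ l')
    (hl' : l' ≤ n) (s s' : ZMod n) :
    compMult (DAlg n q) (RepMod (simpleRep n q l hl s)) (RepMod (simpleRep n q l' hl' s')) =
      if l = l' ∧ s = s' then 1 else 0 := by
  have := isSimpleModule_simpleRep (q := q) h1 hl s
  rw [compMult_of_isSimpleModule]
  refine if_congr ⟨fun ⟨e⟩ => eq_of_linearEquiv_simpleRep h1 hl h1' hl' s s' e, ?_⟩ rfl rfl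
  rintro ⟨rfl, rfl⟩
  exact ⟨LinearEquiv.refl _ _⟩

/-- The zero module `V(0, s)` lets the case `ℓ = 1` of the tensor product rule follow the general
formula. -/
lemma compMult_simpleRep_zero (hl : 0 ≤ n) (s : ZMod n) (S : Type*) [AddCommGroup S]
    [Module (DAlg n q) S] : compMult (DAlg n q) (RepMod (simpleRep n q 0 hl s)) S = 0 := by
  have : Subsingleton (RepMod (simpleRep n q 0 hl s)) :=
    inferInstanceAs (Subsingleton (Fin 0 → k))
  exact compMult_eq_zero_of_subsingleton

end SimpleModules
section TensorProducts

variable {k : Type*} [Field k] {n : ℕ} {q : k} [NeZero n] [hq : Fact (IsPrimitiveRoot q n)]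

/-! ## Tensoring with `V(2, 0)` -/

section ChainAction

variable (hq1 : q ≠ 1) {N : ℕ} (hN : N ≤ n) {L : ZMod n} (s : ZMod n)
  (hL : chainCoeff q L N = 0) (t : ℕ)

lemma chainRep_a : chainRep hq1 N hN L s hL (a n q) (stdVec k N t) = stdVec k N (t + 1) := by
  rw [chainRep, lift_a, opA_stdVec]

lemma chainRep_b : chainRep hq1 N hN L s hL (b n q) (stdVec k N t) =
    qpow q (s + (t : ZMod n)) • stdVec k N t := by
  rw [chainRep, lift_b, opB_stdVec_add]

lemma chainRep_c : chainRep hq1 N hN L s hL (c n q) (stdVec k N t) =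
    qpow q ((t : ZMod n) + 1 - (s + L)) • stdVec k N t := by
  rw [chainRep, lift_c, chainC_stdVec]

lemma chainRep_d : chainRep hq1 N hN L s hL (d n q) (stdVec k N t) =
    chainCoeff q L t • stdVec k N (t - 1) := by
  rw [chainRep, lift_d, chainD_stdVec hL]

end ChainAction

section TwoDimensional

variable (h2 : 2 ≤ n)

lemma simpleRep_two_a_one : simpleRep n q 2 h2 0 (a n q) (stdVec k 2 1) = 0 := by
  rw [simpleRep_a, stdVec_eq_zero le_rfl]

lemma simpleRep_two_b_zero :
    simpleRep n q 2 h2 0 (b n q) (stdVec k 2 0) = stdVec k 2 0 := by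
  simp [simpleRep_b, qpow_zero]

lemma simpleRep_two_b_one :
    simpleRep n q 2 h2 0 (b n q) (stdVec k 2 1) = q • stdVec k 2 1 := by
  simp [simpleRep_b, qpow_one hq.out]

lemma simpleRep_two_c_zero :
    simpleRep n q 2 h2 0 (c n q) (stdVec k 2 0) = q⁻¹ • stdVec k 2 0 := by
  rw [simpleRep_c, show ((0 : ℕ) : ZMod n) + 1 - (0 + (2 : ℕ)) = -1 by push_cast; ring,
    qpow_neg hq.out, qpow_one hq.out]

lemma simpleRep_two_c_one :
    simpleRep n q 2 h2 0 (c n q) (stdVec k 2 1) = stdVec k 2 1 := by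
  rw [simpleRep_c, show ((1 : ℕ) : ZMod n) + 1 - (0 + (2 : ℕ)) = 0 by push_cast; ring,
    qpow_zero, one_smul]

lemma simpleRep_two_d_zero : simpleRep n q 2 h2 0 (d n q) (stdVec k 2 0) = 0 := by
  rw [simpleRep_d, chainCoeff_zero, zero_smul]

lemma simpleRep_two_d_one (hq1 : q ≠ 1) :
    simpleRep n q 2 h2 0 (d n q) (stdVec k 2 1) = (1 - q⁻¹) • stdVec k 2 0 := by
  have h : q - 1 ≠ 0 := sub_ne_zero.mpr hq1
  rw [simpleRep_d, chainCoeff, show ((1 : ℕ) : ZMod n) - (2 : ℕ) = -1 by push_cast; ring,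
    qpow_neg hq.out, qpow_one hq.out, pow_one, mul_div_right_comm, div_self h, one_mul]

section TensorAction

variable {l : ℕ} (hl : l ≤ n) (s : ZMod n) (t : ℕ)

lemma tensor_two_a_zero :
    tensorRep (simpleRep n q l hl s) (simpleRep n q 2 h2 0) (a n q)
      (stdVec k l t ⊗ₜ stdVec k 2 0) =
    stdVec k l (t + 1) ⊗ₜ stdVec k 2 0 + stdVec k l t ⊗ₜ stdVec k 2 1 := by
  rw [tensorRep_a, simpleRep_two_b_zero, simpleRep_a, simpleRep_a]

lemma tensor_two_a_one :
    tensorRep (simpleRep n q l hl s) (simpleRep n q 2 h2 0) (a n q)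
      (stdVec k l t ⊗ₜ stdVec k 2 1) = q • (stdVec k l (t + 1) ⊗ₜ stdVec k 2 1) := by
  rw [tensorRep_a, simpleRep_two_b_one, simpleRep_two_a_one, simpleRep_a, TensorProduct.tmul_zero,
    add_zero, TensorProduct.tmul_smul]

lemma tensor_two_b_zero :
    tensorRep (simpleRep n q l hl s) (simpleRep n q 2 h2 0) (b n q)
      (stdVec k l t ⊗ₜ stdVec k 2 0) =
    qpow q (s + (t : ZMod n)) • (stdVec k l t ⊗ₜ stdVec k 2 0) := by
  rw [tensorRep_b, simpleRep_two_b_zero, simpleRep_b, TensorProduct.smul_tmul']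

lemma tensor_two_b_one :
    tensorRep (simpleRep n q l hl s) (simpleRep n q 2 h2 0) (b n q)
      (stdVec k l t ⊗ₜ stdVec k 2 1) =
    (qpow q (s + (t : ZMod n)) * q) • (stdVec k l t ⊗ₜ stdVec k 2 1) := by
  rw [tensorRep_b, simpleRep_two_b_one, simpleRep_b, TensorProduct.smul_tmul_smul]

lemma tensor_two_c_zero :
    tensorRep (simpleRep n q l hl s) (simpleRep n q 2 h2 0) (c n q)
      (stdVec k l t ⊗ₜ stdVec k 2 0) =
    (qpow q ((t : ZMod n) + 1 - (s + (l : ZMod n))) * q⁻¹) •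
      (stdVec k l t ⊗ₜ stdVec k 2 0) := by
  rw [tensorRep_c, simpleRep_two_c_zero, simpleRep_c, TensorProduct.smul_tmul_smul]

lemma tensor_two_c_one :
    tensorRep (simpleRep n q l hl s) (simpleRep n q 2 h2 0) (c n q)
      (stdVec k l t ⊗ₜ stdVec k 2 1) =
    qpow q ((t : ZMod n) + 1 - (s + (l : ZMod n))) • (stdVec k l t ⊗ₜ stdVec k 2 1) := by
  rw [tensorRep_c, simpleRep_two_c_one, simpleRep_c, TensorProduct.smul_tmul']

lemma tensor_two_d_zero :
    tensorRep (simpleRep n q l hl s) (simpleRep n q 2 h2 0) (d n q)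
      (stdVec k l t ⊗ₜ stdVec k 2 0) =
    (chainCoeff q (l : ZMod n) t * q⁻¹) • (stdVec k l (t - 1) ⊗ₜ stdVec k 2 0) := by
  rw [tensorRep_d, simpleRep_two_c_zero, simpleRep_two_d_zero, simpleRep_d,
    TensorProduct.tmul_zero, add_zero, TensorProduct.smul_tmul_smul]

lemma tensor_two_d_one (hq1 : q ≠ 1) :
    tensorRep (simpleRep n q l hl s) (simpleRep n q 2 h2 0) (d n q)
      (stdVec k l t ⊗ₜ stdVec k 2 1) =
    chainCoeff q (l : ZMod n) t • (stdVec k l (t - 1) ⊗ₜ stdVec k 2 1) +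
      (1 - q⁻¹) • (stdVec k l t ⊗ₜ stdVec k 2 0) := by
  rw [tensorRep_d, simpleRep_two_c_one, simpleRep_two_d_one h2 hq1, simpleRep_d,
    TensorProduct.tmul_smul, TensorProduct.smul_tmul', TensorProduct.smul_tmul']

end TensorAction

end TwoDimensional

/-! ### The `q`-integers and the coefficients of neighbouring weights -/

section QInt

variable {k : Type*} [Field k] {n : ℕ} {q : k}

/-- The `q`-integer `1 + q + ⋯ + q ^ (t - 1)`. -/
def qInt (q : k) (t : ℕ) : k := (q ^ t - 1) / (q - 1)

lemma qInt_zero : qInt q 0 = 0 := by simp [qInt]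

lemma qInt_succ (hq1 : q ≠ 1) (t : ℕ) : qInt q (t + 1) = 1 + q * qInt q t := by
  have h : q - 1 ≠ 0 := sub_ne_zero.mpr hq1
  rw [qInt, qInt]
  field_simp
  ring

lemma chainCoeff_eq_qInt (L : ZMod n) (t : ℕ) :
    chainCoeff q L t = qInt q t * (1 - qpow q ((t : ZMod n) - L)) := by
  rw [chainCoeff, qInt]
  ring

variable [NeZero n]

lemma qpow_succ (hq : IsPrimitiveRoot q n) (x : ZMod n) : qpow q (x + 1) = qpow q x * q := by
  rw [qpow_add hq, qpow_one hq]

lemma qpow_pred (hq : IsPrimitiveRoot q n) (x : ZMod n) : qpow q (x - 1) = qpow q x * q⁻¹ := by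
  rw [qpow_sub hq, qpow_one hq, div_eq_mul_inv]

lemma chainCoeff_add_one (hq : IsPrimitiveRoot q n) (L : ZMod n) (t : ℕ) :
    chainCoeff q (L + 1) t = qInt q t * (1 - qpow q ((t : ZMod n) - L) * q⁻¹) := by
  rw [chainCoeff_eq_qInt, ← sub_sub, qpow_pred hq]

lemma chainCoeff_sub_one (hq : IsPrimitiveRoot q n) (L : ZMod n) (t : ℕ) :
    chainCoeff q (L - 1) t = qInt q t * (1 - qpow q ((t : ZMod n) - L) * q) := by
  rw [chainCoeff_eq_qInt, sub_sub_eq_add_sub, add_sub_right_comm, qpow_succ hq]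

end QInt

/-- `V(ℓ, s) ⊗ V(2, 0)` as an extension of two chains of highest weights `(s + 1, ℓ - 1)` and
`(s, ℓ + 1)`. -/
lemma compMult_tensor_chain (hq1 : q ≠ 1) (h2 : 2 ≤ n) {l : ℕ} (hl1 : 1 ≤ l) (hl : l ≤ n)
    (s : ZMod n) {N N' : ℕ} (hN : N ≤ n) (hN' : N' ≤ n)
    (hcase : (N = l + 1 ∧ N' = l - 1 ∧ l < n) ∨ (N = n ∧ N' = n ∧ l = n))
    (hL : chainCoeff q ((l : ZMod n) + 1) N = 0) (hL' : chainCoeff q ((l : ZMod n) - 1) N' = 0)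
    (h1 : IsFiniteLength (DAlg n q) (RepMod (chainRep hq1 N hN _ s hL)))
    (h1' : IsFiniteLength (DAlg n q) (RepMod (chainRep hq1 N' hN' _ (s + 1) hL')))
    (S : Type*) [AddCommGroup S] [Module (DAlg n q) S] :
    compMult (DAlg n q)
        (RepMod (tensorRep (simpleRep n q l hl s) (simpleRep n q 2 h2 0))) S =
      compMult (DAlg n q) (RepMod (chainRep hq1 N hN _ s hL)) S +
      compMult (DAlg n q) (RepMod (chainRep hq1 N' hN' _ (s + 1) hL')) S := by
  have hq' := hq.out
  have hq0 : q ≠ 0 := hq'.ne_zero (NeZero.ne n)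
  have hqn : qInt q n = 0 := by simp [qInt, hq'.pow_eq_one]
  -- The image of the `t`th vector is `a ^ t (v_0 ⊗ e_0)`; its second coefficient obeys `x_{t+1} = 1
  -- + q x_t`, which defines the `q`-integers. It vanishes at `t = N`: for `l < n` because the
  -- vectors run out, and for `l = n` because `qInt q n = 0`.
  obtain ⟨i, hi⟩ : ∃ i : (Fin N → k) →ₗ[k] (Fin l → k) ⊗[k] (Fin 2 → k),
      ∀ t, i (stdVec k N t) = stdVec k l t ⊗ₜ stdVec k 2 0 +
        qInt q t • (stdVec k l (t - 1) ⊗ₜ stdVec k 2 1) := by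
    refine exists_stdMap fun t ht => ?_
    rw [stdVec_eq_zero (by omega : l ≤ t), TensorProduct.zero_tmul, zero_add]
    rcases Nat.lt_or_ge (t - 1) l with h | h
    · rw [show t = n by omega, hqn, zero_smul]
    · rw [stdVec_eq_zero h, TensorProduct.zero_tmul, smul_zero]
  -- The quotient is generated by the image of `v_0 ⊗ e_1`. Since `a ^ t (v_0 ⊗ e_1) = q ^ t (v_t ⊗
  -- e_1)`, the map on `V ⊗ e_1` is `Q` below; the map `P` on `V ⊗ e_0` is then forced by the
  -- vanishing on the image of `i`.
  obtain ⟨P, hP⟩ : ∃ P : (Fin l → k) →ₗ[k] (Fin N' → k),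
      ∀ t, P (stdVec k l t) = -(qInt q t * (q * (q ^ t)⁻¹)) • stdVec k N' (t - 1) := by
    refine exists_stdMap fun t ht => ?_
    rcases Nat.lt_or_ge (t - 1) N' with h | h
    · rw [show t = n by omega, hqn, zero_mul, neg_zero, zero_smul]
    · rw [stdVec_eq_zero h, smul_zero]
  obtain ⟨Q, hQ⟩ : ∃ Q : (Fin l → k) →ₗ[k] (Fin N' → k),
      ∀ t, Q (stdVec k l t) = (q ^ t)⁻¹ • stdVec k N' t :=
    exists_stdMap fun t ht => by rw [stdVec_eq_zero (by omega), smul_zero]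
  -- A left inverse of `i`. The component along `e_0` recovers the vectors of index below `l`; if `N
  -- = l + 1`, the last one is recovered from `qInt q l • (v_{l-1} ⊗ e_1)`, where `qInt q l ≠ 0`
  -- because `l < n`.
  obtain ⟨P', hP'⟩ : ∃ P' : (Fin l → k) →ₗ[k] (Fin N → k),
      ∀ t, P' (stdVec k l t) = if t < l then stdVec k N t else 0 :=
    exists_stdMap fun t ht => if_neg (by omega)
  obtain ⟨Q', hQ'⟩ : ∃ Q' : (Fin l → k) →ₗ[k] (Fin N → k),
      ∀ t, Q' (stdVec k l t) = if t + 1 = l then (qInt q l)⁻¹ • stdVec k N l else 0 :=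
    exists_stdMap fun t ht => if_neg (by omega)
  refine (compMult_repMod_of_exact h1 h1' i (pairMap P Q) ?_ ?_ ?_ ?_ ?_ ?_ S).2
  · refine Function.LeftInverse.injective (g := pairMap P' Q')
      (leftInverse_of_stdVec fun t ht => ?_)
    rw [hi, map_add, map_smul, pairMap_zero, pairMap_one, hP', hQ']
    rcases Nat.lt_or_ge t l with h | h
    · rw [if_pos h]
      cases t with
      | zero => rw [qInt_zero, zero_smul, add_zero]
      | succ t => rw [if_neg (by omega), smul_zero, add_zero]
    · obtain rfl : t = l := by omega
      have hne : qInt q t ≠ 0 := div_ne_zero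
        (sub_ne_zero.mpr (hq'.pow_ne_one_of_pos_of_lt (by omega) (by omega)))
        (sub_ne_zero.mpr hq1)
      rw [if_neg (by omega), if_pos (by omega), smul_smul, mul_inv_cancel₀ hne, one_smul,
        zero_add]
  · refine Function.RightInverse.surjective
      (g := stdMap k N' fun t => q ^ t • (stdVec k l t ⊗ₜ stdVec k 2 1))
      (leftInverse_of_stdVec fun t ht => ?_)
    rw [stdMap_stdVec _ _ ht, map_smul, pairMap_one, hQ, smul_smul,
      mul_inv_cancel₀ (pow_ne_zero t hq0), one_smul]
  · refine hom_ext_stdVec fun t _ => ?_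
    rw [LinearMap.comp_apply, hi, map_add, map_smul, pairMap_zero, pairMap_one, hP, hQ,
      LinearMap.zero_apply]
    cases t with
    | zero => rw [qInt_zero, zero_mul, neg_zero, zero_smul, zero_smul, add_zero]
    | succ t =>
      rw [Nat.add_sub_cancel]
      match_scalars
      rw [pow_succ]
      field_simp
      ring
  -- In both cases `N + N' = 2 l`.
  · rw [Module.finrank_tensorProduct]
    simp only [Module.finrank_fin_fun]
    omega
  · refine intertwines _ ?_ ?_ ?_ ?_ <;> refine hom_ext_stdVec fun t _ => ?_
    · rw [LinearMap.comp_apply, LinearMap.comp_apply, chainRep_a, hi, hi, map_add, map_smul,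
        tensor_two_a_zero, tensor_two_a_one, Nat.add_sub_cancel, qInt_succ hq1]
      cases t with
      | zero => simp [qInt_zero]
      | succ t => rw [Nat.add_sub_cancel]; module
    · rw [LinearMap.comp_apply, LinearMap.comp_apply, chainRep_b, map_smul, hi, map_add, map_smul,
        tensor_two_b_zero, tensor_two_b_one]
      cases t with
      | zero => simp [qInt_zero]
      | succ t => rw [Nat.add_sub_cancel, Nat.cast_succ, ← add_assoc, qpow_succ hq']; module
    · have hc : (t : ZMod n) + 1 - (s + (l + 1)) = t + 1 - (s + l) - 1 := by ring
      rw [LinearMap.comp_apply, LinearMap.comp_apply, chainRep_c, map_smul, hi, map_add, map_smul,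
        tensor_two_c_zero, tensor_two_c_one, hc, qpow_pred hq']
      cases t with
      | zero => simp [qInt_zero]
      | succ t =>
        rw [Nat.add_sub_cancel, Nat.cast_succ, add_sub_right_comm, qpow_succ hq',
          mul_inv_cancel_right₀ hq0]
        match_scalars <;> field_simp
    · rw [LinearMap.comp_apply, LinearMap.comp_apply, chainRep_d, map_smul, hi, hi, map_add,
        map_smul, tensor_two_d_zero, tensor_two_d_one _ _ _ _ hq1, chainCoeff_add_one hq',
        chainCoeff_eq_qInt, chainCoeff_eq_qInt]
      cases t with
      | zero => simp [qInt_zero]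
      | succ t =>
        rw [Nat.add_sub_cancel, Nat.cast_succ, add_sub_right_comm, qpow_succ hq']
        match_scalars
        · field_simp
          ring
        · field_simp
  · refine intertwines _ ?_ ?_ ?_ ?_ <;> refine tensor_hom_ext (fun t _ => ?_) (fun t _ => ?_)
    · rw [LinearMap.comp_apply, LinearMap.comp_apply, tensor_two_a_zero, map_add, pairMap_zero,
        pairMap_zero, pairMap_one, hP, hP, hQ, map_smul, chainRep_a, Nat.add_sub_cancel,
        qInt_succ hq1]
      cases t with
      | zero => simp [qInt_zero, hq0]
      | succ t =>
        rw [Nat.add_sub_cancel]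
        match_scalars
        field_simp
        ring
    · rw [LinearMap.comp_apply, LinearMap.comp_apply, tensor_two_a_one, map_smul, pairMap_one,
        pairMap_one, hQ, hQ, map_smul, chainRep_a, smul_smul, pow_succ]
      match_scalars
      field_simp
    · rw [LinearMap.comp_apply, LinearMap.comp_apply, tensor_two_b_zero, map_smul, pairMap_zero,
        hP, map_smul, chainRep_b]
      cases t with
      | zero => simp [qInt_zero]
      | succ t =>
        rw [Nat.add_sub_cancel, Nat.cast_succ, add_right_comm s 1, add_assoc s]
        module
    · rw [LinearMap.comp_apply, LinearMap.comp_apply, tensor_two_b_one, map_smul, pairMap_one,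
        hQ, map_smul, chainRep_b, add_right_comm s 1, qpow_succ hq']
      module
    · have hc : ∀ t : ZMod n, t + 1 - (s + 1 + (l - 1)) = t + 1 - (s + l) := fun t => by ring
      rw [LinearMap.comp_apply, LinearMap.comp_apply, tensor_two_c_zero, map_smul, pairMap_zero,
        hP, map_smul, chainRep_c, hc]
      cases t with
      | zero => simp [qInt_zero]
      | succ t =>
        rw [Nat.add_sub_cancel, Nat.cast_succ, add_sub_right_comm, qpow_succ hq',
          mul_inv_cancel_right₀ hq0]
        module
    · have hc : (t : ZMod n) + 1 - (s + 1 + (l - 1)) = t + 1 - (s + l) := by ring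
      rw [LinearMap.comp_apply, LinearMap.comp_apply, tensor_two_c_one, map_smul, pairMap_one,
        hQ, map_smul, chainRep_c, hc]
      module
    · rw [LinearMap.comp_apply, LinearMap.comp_apply, tensor_two_d_zero, map_smul, pairMap_zero,
        pairMap_zero, hP, hP, map_smul, chainRep_d, chainCoeff_sub_one hq', chainCoeff_eq_qInt]
      cases t with
      | zero => simp [qInt_zero]
      | succ t =>
        rw [Nat.add_sub_cancel, Nat.cast_succ, add_sub_right_comm, qpow_succ hq']
        match_scalars
        field_simp
        ring
    · rw [LinearMap.comp_apply, LinearMap.comp_apply, tensor_two_d_one _ _ _ _ hq1, map_add,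
        map_smul, map_smul, pairMap_zero, pairMap_one, pairMap_one, hP, hQ, hQ, map_smul,
        chainRep_d, chainCoeff_sub_one hq', chainCoeff_eq_qInt]
      cases t with
      | zero => simp [qInt_zero]
      | succ t =>
        rw [Nat.add_sub_cancel]
        match_scalars
        field_simp
        ring

/-- Composition multiplicities of a chain of full length. -/
lemma compMult_chainRep_eq (hq1 : q ≠ 1) {M M' : ℕ} (h : M + M' = n) {L s s' : ZMod n}
    (hL : L = M) (hs : s' = s + M) (S : Type*) [AddCommGroup S] [Module (DAlg n q) S] :
    IsFiniteLength (DAlg n q)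
      (RepMod (chainRep hq1 n le_rfl L s (chainCoeff_period hq.out L))) ∧
    compMult (DAlg n q) (RepMod (chainRep hq1 n le_rfl L s (chainCoeff_period hq.out L))) S =
      compMult (DAlg n q) (RepMod (simpleRep n q M' (by omega) s')) S +
      compMult (DAlg n q) (RepMod (simpleRep n q M (by omega) s)) S := by
  obtain rfl : M' = n - M := by omega
  subst hL hs
  exact compMult_chainRep hq1 M (by omega) s (isFiniteLength_simpleRep _ _ _)
    (isFiniteLength_simpleRep _ _ _) S

/-- Composition multiplicities of `V(ℓ, s) ⊗ V(2, 0)` for `ℓ < n`. -/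
lemma compMult_tensor_of_lt (h2 : 2 ≤ n) {l : ℕ} (hl1 : 1 ≤ l) (hl : l < n) (s : ZMod n)
    (S : Type*) [AddCommGroup S] [Module (DAlg n q) S] :
    compMult (DAlg n q)
        (RepMod (tensorRep (simpleRep n q l hl.le s) (simpleRep n q 2 h2 0))) S =
      compMult (DAlg n q) (RepMod (simpleRep n q (l + 1) hl s)) S +
      compMult (DAlg n q) (RepMod (simpleRep n q (l - 1) (by omega) (s + 1))) S := by
  have hq1 : q ≠ 1 := hq.out.ne_one (by omega)
  have e1 : ((l + 1 : ℕ) : ZMod n) = l + 1 := Nat.cast_succ l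
  have e2 : ((l - 1 : ℕ) : ZMod n) = l - 1 := by rw [Nat.cast_sub hl1, Nat.cast_one]
  have r1 : simpleRep n q (l + 1) hl s = chainRep hq1 (l + 1) hl ((l : ZMod n) + 1) s
      (by rw [← e1]; exact chainCoeff_self _) := by
    simp only [simpleRep_eq_chainRep hq1, e1]
  have r2 : simpleRep n q (l - 1) (by omega) (s + 1) =
      chainRep hq1 (l - 1) (by omega) ((l : ZMod n) - 1) (s + 1) (by rw [← e2]; exact chainCoeff_self _) := by
    simp only [simpleRep_eq_chainRep hq1, e2]
  have f1 := isFiniteLength_simpleRep (q := q) (l + 1) hl s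
  have f2 := isFiniteLength_simpleRep (q := q) (l - 1) (by omega) (s + 1)
  rw [r1] at f1 ⊢
  rw [r2] at f2 ⊢
  exact compMult_tensor_chain hq1 h2 hl1 hl.le s hl (by omega) (.inl ⟨rfl, rfl, hl⟩) _ _ f1 f2 S

/-- Composition multiplicities of `V(n, s) ⊗ V(2, 0)`. -/
lemma compMult_tensor_top (h2 : 2 ≤ n) (s : ZMod n)
    (S : Type*) [AddCommGroup S] [Module (DAlg n q) S] :
    compMult (DAlg n q)
        (RepMod (tensorRep (simpleRep n q n le_rfl s) (simpleRep n q 2 h2 0))) S =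
      2 * compMult (DAlg n q) (RepMod (simpleRep n q (n - 1) (Nat.sub_le n 1) (s + 1))) S +
      2 * compMult (DAlg n q) (RepMod (simpleRep n q 1 (by omega) s)) S := by
  have hq1 : q ≠ 1 := hq.out.ne_one (by omega)
  have e : (n : ZMod n) - 1 = (n - 1 : ℕ) := by rw [Nat.cast_sub (by omega), Nat.cast_one]
  -- Modulo `n` the weights `n + 1` and `n - 1` are `1` and `-1`. The two chains split at `M = 1`
  -- and at `M = n - 1` into the same two simple modules with the roles of sub and quotient
  -- exchanged, whence the factors `2`.
  have h1 := compMult_chainRep_eq hq1 (M := 1) (M' := n - 1) (by omega)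
    (L := (n : ZMod n) + 1) (s := s) (s' := s + 1) (by simp) (by simp) S
  have h3 := compMult_chainRep_eq hq1 (M := n - 1) (M' := 1) (by omega)
    (L := (n : ZMod n) - 1) (s := s + 1) (s' := s) e (by rw [← e]; simp) S
  rw [compMult_tensor_chain hq1 h2 (by omega) le_rfl s le_rfl le_rfl (.inr ⟨rfl, rfl, rfl⟩)
    (chainCoeff_period hq.out _) (chainCoeff_period hq.out _) h1.1 h3.1 S, h1.2, h3.2]
  ring

end TensorProducts
/-! ## The action of the McKay matrix -/

section McKayAction

variable {k : Type*} [Field k] {n : ℕ}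

/-- The entries of a vector indexed by all natural numbers `ℓ`, with zeros outside `1 ≤ ℓ ≤ n`. -/
def entry (w : SimpleIdx n → k) (l : ℕ) (s : ZMod n) : k :=
  if h : l ∈ Finset.Icc 1 n then w (⟨l, h⟩, s) else 0

lemma entry_of_mem (w : SimpleIdx n → k) (p : SimpleIdx n) : entry w p.1 p.2 = w p :=
  dif_pos p.1.2

lemma entry_zero (w : SimpleIdx n → k) (s : ZMod n) : entry w 0 s = 0 :=
  dif_neg (by simp)

variable {q : k} [NeZero n] [hq : Fact (IsPrimitiveRoot q n)]

lemma sum_compMult_mul (w : SimpleIdx n → k) (l : ℕ) (hl : l ≤ n) (s : ZMod n) :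
    ∑ p : SimpleIdx n, (compMult (DAlg n q) (RepMod (simpleRep n q l hl s))
      (RepMod (simpleRep n q p.1 p.le p.2)) : k) * w p = entry w l s := by
  rcases Nat.eq_zero_or_pos l with rfl | h
  · rw [entry_zero]
    exact Finset.sum_eq_zero fun p _ => by rw [compMult_simpleRep_zero, Nat.cast_zero, zero_mul]
  · have hmem : l ∈ Finset.Icc 1 n := Finset.mem_Icc.mpr ⟨h, hl⟩
    rw [Finset.sum_eq_single (⟨l, hmem⟩, s)]
    · rw [compMult_simpleRep h hl h hl, if_pos ⟨rfl, rfl⟩, Nat.cast_one, one_mul, entry,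
        dif_pos hmem]
    · intro p _ hp
      rw [compMult_simpleRep h hl (Finset.mem_Icc.mp p.1.2).1 (SimpleIdx.le p), if_neg,
        Nat.cast_zero, zero_mul]
      rintro ⟨h1, h2⟩
      exact hp (Prod.ext (Subtype.ext h1.symm) h2.symm)
    · simp

lemma mcKay_mulVec_of_lt (h2 : 2 ≤ n) (w : SimpleIdx n → k) (p : SimpleIdx n)
    (hp : (p.1 : ℕ) < n) :
    (mcKay n q (simpleRep n q 2 h2 0)).mulVec w p =
      entry w (p.1 + 1) p.2 + entry w (p.1 - 1) (p.2 + 1) := by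
  rw [← sum_compMult_mul (q := q) w (p.1 + 1) hp,
    ← sum_compMult_mul (q := q) w (p.1 - 1) (by omega),
    ← Finset.sum_add_distrib, Matrix.mulVec, dotProduct]
  refine Finset.sum_congr rfl fun p' _ => ?_
  rw [mcKay, Matrix.of_apply, compMult_tensor_of_lt h2 (Finset.mem_Icc.mp p.1.2).1 hp,
    Nat.cast_add, add_mul]

lemma mcKay_mulVec_of_eq (h2 : 2 ≤ n) (w : SimpleIdx n → k) (p : SimpleIdx n)
    (hp : (p.1 : ℕ) = n) :
    (mcKay n q (simpleRep n q 2 h2 0)).mulVec w p =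
      2 * entry w (n - 1) (p.2 + 1) + 2 * entry w 1 p.2 := by
  rw [← sum_compMult_mul (q := q) w (n - 1) (by omega),
    ← sum_compMult_mul (q := q) w 1 (by omega),
    Finset.mul_sum, Finset.mul_sum, ← Finset.sum_add_distrib, Matrix.mulVec, dotProduct]
  refine Finset.sum_congr rfl fun p' _ => ?_
  obtain ⟨⟨l, hl⟩, s⟩ := p
  obtain rfl : l = n := hp
  rw [mcKay, Matrix.of_apply, compMult_tensor_top h2]
  push_cast
  ring

/-- The eigenvector equation as a recursion. -/
lemma mcKay_mulVec_eq_smul_iff (h2 : 2 ≤ n) (w : SimpleIdx n → k) (μ : k) :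
    (mcKay n q (simpleRep n q 2 h2 0)).mulVec w = μ • w ↔
      (∀ m, m + 1 < n → ∀ s, entry w (m + 2) s + entry w m (s + 1) = μ * entry w (m + 1) s) ∧
      ∀ s, 2 * entry w (n - 1) (s + 1) + 2 * entry w 1 s = μ * entry w n s := by
  constructor
  · intro h
    refine ⟨fun m hm s => ?_, fun s => ?_⟩
    · have hmem : m + 1 ∈ Finset.Icc 1 n := Finset.mem_Icc.mpr ⟨by omega, by omega⟩
      have h1 := congrFun h (⟨m + 1, hmem⟩, s)
      rw [mcKay_mulVec_of_lt h2 _ _ hm, Pi.smul_apply, ← entry_of_mem w] at h1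
      exact h1
    · have hmem : n ∈ Finset.Icc 1 n := Finset.mem_Icc.mpr ⟨by omega, le_rfl⟩
      have h1 := congrFun h (⟨n, hmem⟩, s)
      rw [mcKay_mulVec_of_eq h2 _ _ rfl, Pi.smul_apply, ← entry_of_mem w] at h1
      exact h1
  · rintro ⟨h1, h3⟩
    ext p
    rw [Pi.smul_apply, smul_eq_mul, ← entry_of_mem w p]
    have hp1 := (Finset.mem_Icc.mp p.1.2).1
    rcases p.le.eq_or_lt with hp | hp
    · rw [mcKay_mulVec_of_eq h2 _ _ hp, h3, hp]
    · have h := h1 (p.1 - 1) (by omega) p.2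
      rw [show (p.1 : ℕ) - 1 + 2 = p.1 + 1 by omega, show (p.1 : ℕ) - 1 + 1 = p.1 by omega] at h
      rw [mcKay_mulVec_of_lt h2 _ _ hp, h]

end McKayAction

/-! ## Chebyshev polynomials -/

section Chebyshev

variable {k : Type*} [Field k]

lemma chebU_zero (x : k) : chebU 0 x = 1 := by simp [chebU]

lemma chebU_one [NeZero (2 : k)] (x : k) : chebU 1 x = x := by
  simp [chebU, mul_div_cancel₀ x (NeZero.ne (2 : k))]

lemma chebU_add_two [NeZero (2 : k)] (m : ℕ) (x : k) :
    chebU (m + 2) x = x * chebU (m + 1) x - chebU m x := by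
  have h : (2 : k) ≠ 0 := NeZero.ne 2
  simp only [chebU, Nat.cast_add, Nat.cast_ofNat, Nat.cast_one, Polynomial.Chebyshev.U_add_two]
  simp only [Polynomial.eval_sub, Polynomial.eval_mul, Polynomial.eval_ofNat, Polynomial.eval_X]
  field_simp

/-- A division-free form of `U_m(z + z⁻¹) = (z ^ (m+1) - z ^ (-m-1)) / (z - z⁻¹)`, valid also for `z
= ±1`. -/
lemma pow_mul_chebU [NeZero (2 : k)] {z : k} (hz : z ≠ 0) (m : ℕ) :
    z ^ m * chebU m (z + z⁻¹) = ∑ t ∈ Finset.range (m + 1), z ^ (2 * t) := by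
  induction m using Nat.twoStepInduction with
  | zero => simp [chebU_zero]
  | one =>
    rw [chebU_one, Finset.sum_range_succ, Finset.sum_range_one]
    field_simp
    ring
  | more m h1 h2 =>
    have h3 : z ^ (m + 2) * chebU (m + 2) (z + z⁻¹) =
        (z ^ 2 + 1) * (z ^ (m + 1) * chebU (m + 1) (z + z⁻¹)) -
          z ^ 2 * (z ^ m * chebU m (z + z⁻¹)) := by
      rw [chebU_add_two]
      generalize chebU (m + 1) (z + z⁻¹) = A
      generalize chebU m (z + z⁻¹) = B
      field_simp
      ring
    rw [h3, h1, h2, Finset.sum_range_succ _ (m + 2), Finset.sum_range_succ _ (m + 1)]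
    ring

/-- Consecutive sums of even powers differ only in their end terms. This is the identity `U_{m+2} -
U_m = z ^ (m+2) + z ^ (-(m+2))`, cleared of denominators. -/
lemma pow_mul_chebU_sub [NeZero (2 : k)] {z : k} (hz : z ≠ 0) (m : ℕ) :
    z ^ (m + 2) * (chebU (m + 2) (z + z⁻¹) - chebU m (z + z⁻¹)) = z ^ (2 * (m + 2)) + 1 := by
  rw [mul_sub, pow_mul_chebU hz, pow_add z m 2, mul_comm (z ^ m), mul_assoc, pow_mul_chebU hz,
    Finset.sum_range_succ, Finset.sum_range_succ', Finset.mul_sum, mul_zero, pow_zero]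
  simp only [mul_add, pow_add, mul_one]
  rw [Finset.sum_congr rfl fun t _ => mul_comm (z ^ (2 * t)) (z ^ 2)]
  ring

/-- The last equation of the recursion characterises the sums `z + z⁻¹` with `z ^ n = 1`. -/
lemma chebU_last_iff [NeZero (2 : k)] {z : k} (hz : z ≠ 0) (m : ℕ) :
    (z + z⁻¹) * chebU (m + 1) (z + z⁻¹) = 2 * chebU m (z + z⁻¹) + 2 ↔ z ^ (m + 2) = 1 := by
  have h1 := chebU_add_two m (z + z⁻¹)
  have h2 := pow_mul_chebU_sub hz m
  have hz2 : z ^ (m + 2) ≠ 0 := pow_ne_zero _ hz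
  -- By the Chebyshev recursion the difference of the two sides is `U_{m+2} - U_m - 2`; multiplied
  -- by `z ^ (m+2)` it becomes a perfect square.
  have h3 : (z ^ (m + 2) - 1) ^ 2 = z ^ (m + 2) * ((z + z⁻¹) * chebU (m + 1) (z + z⁻¹) -
      (2 * chebU m (z + z⁻¹) + 2)) := by
    rw [h1, pow_mul' z 2 (m + 2)] at h2
    linear_combination -h2
  rw [← sub_eq_zero, ← mul_right_inj' hz2, ← h3, mul_zero, sq_eq_zero_iff, sub_eq_zero]

end Chebyshev

/-! ## Characters of group-like elements -/

section Characters

variable {k : Type*} [Field k] {n : ℕ} {q : k} [NeZero n]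

lemma trace_of_stdVec {l : ℕ} {f : Module.End k (Fin l → k)} {μ : ℕ → k}
    (h : ∀ t, f (stdVec k l t) = μ t • stdVec k l t) :
    LinearMap.trace k (Fin l → k) f = ∑ t ∈ Finset.range l, μ t := by
  rw [LinearMap.trace_eq_matrix_trace k (Pi.basisFun k (Fin l)), Matrix.trace,
    Finset.sum_range]
  refine Finset.sum_congr rfl fun u _ => ?_
  rw [Matrix.diag_apply, LinearMap.toMatrix_apply, ← stdVec_val, h]
  simp [stdVec]

lemma qpow_pow_val (hq : IsPrimitiveRoot q n) (x i : ZMod n) :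
    qpow q x ^ i.val = qpow q (i * x) := by
  rw [← qpow_natCast_mul hq, ZMod.natCast_zmod_val]

lemma end_pow_stdVec {l : ℕ} {f : Module.End k (Fin l → k)} {c : k} {t : ℕ}
    (h : f (stdVec k l t) = c • stdVec k l t) (m : ℕ) :
    (f ^ m) (stdVec k l t) = c ^ m • stdVec k l t := by
  induction m with
  | zero => simp
  | succ m ih => rw [pow_succ', Module.End.mul_apply, ih, map_smul, h, smul_smul, pow_succ]

variable [hq : Fact (IsPrimitiveRoot q n)]

lemma eta_grp (l : ℕ) (hl : l ≤ n) (s i m : ZMod n) :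
    eta n q l hl s (grp n q i m) = ∑ t ∈ Finset.range l,
      qpow q (i * (s + (t : ZMod n)) + m * ((t : ZMod n) + 1 - (s + (l : ZMod n)))) := by
  refine trace_of_stdVec fun t => ?_
  rw [grp, map_mul, map_pow, map_pow, Module.End.mul_apply,
    end_pow_stdVec (simpleRep_c l hl s t), map_smul, end_pow_stdVec (simpleRep_b l hl s t),
    smul_smul, qpow_pow_val hq.out, qpow_pow_val hq.out, ← qpow_add hq.out, add_comm]

lemma eta_two_grp (h2 : 2 ≤ n) (i m : ZMod n) :
    eta n q 2 h2 0 (grp n q i m) = qpow q i + qpow q (-m) := by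
  rw [eta_grp, Finset.sum_range_succ, Finset.sum_range_one, add_comm]
  congr 2 <;> push_cast <;> ring

/-- For exponents `j + r` and `j - r`, the `t`th diagonal entry is `q` to the power `j (2 t + 1 - l)
+ r (l + 2 s - 1)`. The part with `r` does not depend on `t`, and the part with `j` is `z ^ (2 t -
(l - 1))` with `z = q ^ j`, so that the sum is the one in `pow_mul_chebU`. -/
lemma eta_grp_eq_chebU [NeZero (2 : k)] {l : ℕ} (h1 : 1 ≤ l) (hl : l ≤ n) (s j r : ZMod n) :
    eta n q l hl s (grp n q (j + r) (j - r)) =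
      qpow q (((l : ZMod n) + 2 * s - 1) * r) * chebU (l - 1) (qpow q j + qpow q (-j)) := by
  obtain ⟨m, rfl⟩ : ∃ m, l = m + 1 := ⟨l - 1, by omega⟩
  have hz := qpow_ne_zero hq.out j
  rw [eta_grp, Nat.add_sub_cancel, qpow_neg hq.out]
  refine mul_left_cancel₀ (pow_ne_zero m hz) ?_
  rw [mul_left_comm, pow_mul_chebU hz, Finset.mul_sum, Finset.mul_sum]
  refine Finset.sum_congr rfl fun t _ => ?_
  rw [← qpow_natCast_mul hq.out, ← qpow_natCast_mul hq.out, ← qpow_add hq.out, ← qpow_add hq.out]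
  congr 1
  push_cast
  ring

end Characters

/-! ## Halving residues modulo an odd number -/

section Halving

variable {n : ℕ}

lemma exists_two_mul_eq_one (hodd : Odd n) : ∃ h : ZMod n, 2 * h = 1 := by
  obtain ⟨m, rfl⟩ := hodd
  refine ⟨((m + 1 : ℕ) : ZMod (2 * m + 1)), ?_⟩
  have h := ZMod.natCast_self (2 * m + 1)
  push_cast at h ⊢
  linear_combination h

lemma two_mul_cancel (hodd : Odd n) {x y : ZMod n} (h : 2 * x = 2 * y) : x = y := by
  obtain ⟨u, hu⟩ := exists_two_mul_eq_one hodd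
  linear_combination u * h - (x - y) * hu

lemma halves_iff (hodd : Odd n) (i m j r : ZMod n) :
    Halves i m j r ↔ (i = j + r ∧ m = j - r) ∨ (i = -j + r ∧ m = -j - r) := by
  constructor
  · rintro ⟨h1 | h1, h2⟩
    · exact .inl ⟨two_mul_cancel hodd (by linear_combination -h1 - h2),
        two_mul_cancel hodd (by linear_combination -h1 + h2)⟩
    · exact .inr ⟨two_mul_cancel hodd (by linear_combination h1 - h2),
        two_mul_cancel hodd (by linear_combination h1 + h2)⟩
  · rintro (⟨rfl, rfl⟩ | ⟨rfl, rfl⟩)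
    · exact ⟨.inl (by ring), by ring⟩
    · exact ⟨.inr (by ring), by ring⟩

/-- The substitution `(i, m) ↦ (-m, -i)` fixes `i - m` and changes the sign of `i + m`, which only
exchanges the two alternatives. The symmetry of the characters comes from this. -/
lemma Halves.symm {i m j r : ZMod n} (h : Halves i m j r) : Halves (-m) (-i) j r :=
  ⟨h.1.symm.imp (fun h => by rw [h]; ring) (fun h => by rw [h]; ring), by rw [h.2]; ring⟩

lemma exists_halves [NeZero n] (hodd : Odd n) (i m : ZMod n) :
    ∃ (j : ℕ) (r : ZMod n), j ≤ (n - 1) / 2 ∧ Halves i m (j : ZMod n) r := by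
  obtain ⟨u, hu⟩ := exists_two_mul_eq_one hodd
  obtain ⟨x, hx⟩ : ∃ x : ZMod n, x = u * (i + m) := ⟨_, rfl⟩
  have hr : 2 * (u * (i - m)) = i - m := by linear_combination (i - m) * hu
  have h2 : 2 * x = i + m := by rw [hx]; linear_combination (i + m) * hu
  have hlt := ZMod.val_lt x
  -- One of the residues `x` and `-x` has its representative in the lower half.
  rcases le_or_gt x.val ((n - 1) / 2) with h | h
  · exact ⟨x.val, u * (i - m), h, .inl (by rw [ZMod.natCast_zmod_val, h2]), hr⟩
  · refine ⟨n - x.val, u * (i - m), ?_, .inr ?_, hr⟩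
    · obtain ⟨t, rfl⟩ := hodd
      omega
    · rw [Nat.cast_sub hlt.le, ZMod.natCast_zmod_val, ZMod.natCast_self, ← h2]
      ring

end Halving

/-! ## Sums of two roots of unity -/

section RootsOfUnity

variable {k : Type*} [Field k] {n : ℕ} [NeZero n] {q : k}

/-- Orthogonality of characters: multiplication by `q ^ (2 x)` permutes the terms, and `q ^ (2 x) ≠
1` for `x ≠ 0` because `2` is invertible modulo `n`. -/
lemma sum_qpow_mul (hodd : Odd n) (hq : IsPrimitiveRoot q n) (x : ZMod n) :
    ∑ r : ZMod n, qpow q (2 * r * x) = if x = 0 then (n : k) else 0 := by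
  split_ifs with hx
  · simp [hx, qpow_zero, ZMod.card]
  · have h1 : (∑ r : ZMod n, qpow q (2 * r * x)) * qpow q (2 * x) =
        ∑ r : ZMod n, qpow q (2 * r * x) := by
      rw [Finset.sum_mul,
        ← Equiv.sum_comp (Equiv.addRight (1 : ZMod n)) (fun r => qpow q (2 * r * x))]
      refine Finset.sum_congr rfl fun r _ => ?_
      rw [← qpow_add hq, Equiv.coe_addRight]
      congr 1
      ring
    have h2 : qpow q (2 * x) ≠ 1 := by
      rw [Ne, qpow_eq_one_iff hq]
      exact fun h => hx (two_mul_cancel hodd (h.trans (mul_zero 2).symm))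
    exact (mul_eq_zero.mp (show (∑ r : ZMod n, qpow q (2 * r * x)) * (qpow q (2 * x) - 1) = 0 by
      rw [mul_sub, h1, mul_one, sub_self])).resolve_right (sub_ne_zero.mpr h2)

variable [CharZero k]

/-- A linear relation between powers of `q` is stable under inversion. -/
lemma qpow_neg_add_qpow_neg (hq : IsPrimitiveRoot q n) {α β γ δ : ZMod n}
    (h : qpow q α + qpow q β = qpow q γ + qpow q δ) :
    qpow q (-α) + qpow q (-β) = qpow q (-γ) + qpow q (-δ) := by
  open Polynomial in
  have hpos : 0 < n := NeZero.pos n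
  let P : ℤ[X] := X ^ α.val + X ^ β.val - (X ^ γ.val + X ^ δ.val)
  have h1 : aeval q P = 0 := by
    simp only [P, map_sub, map_add, map_pow, aeval_X]
    exact sub_eq_zero.mpr h
  -- Both `q` and `q⁻¹` are primitive, so they share the `n`th cyclotomic polynomial as minimal
  -- polynomial over `ℤ`. This replaces complex conjugation.
  have h2 : minpoly ℤ q⁻¹ ∣ P := by
    rw [← cyclotomic_eq_minpoly hq.inv hpos, cyclotomic_eq_minpoly hq hpos]
    exact minpoly.isIntegrallyClosed_dvd (hq.isIntegral hpos) h1
  have h3 : aeval q⁻¹ P = 0 := by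
    obtain ⟨R, hR⟩ := h2
    rw [hR, map_mul, minpoly.aeval, zero_mul]
  simp only [P, map_sub, map_add, map_pow, aeval_X, inv_pow] at h3
  simp only [qpow_neg hq]
  exact sub_eq_zero.mp h3

/-- A sum of two roots of unity of odd order determines the two roots. -/
lemma eq_or_eq_of_qpow_add (hodd : Odd n) (hq : IsPrimitiveRoot q n) {α β γ δ : ZMod n}
    (h : qpow q α + qpow q β = qpow q γ + qpow q δ) :
    (α = γ ∧ β = δ) ∨ (α = δ ∧ β = γ) := by
  have h' := qpow_neg_add_qpow_neg hq h
  simp only [qpow_neg hq] at h'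
  have hinj := qpow_injective hq
  have ha := qpow_ne_zero hq α
  have hb := qpow_ne_zero hq β
  have hc := qpow_ne_zero hq γ
  have hd := qpow_ne_zero hq δ
  -- Two roots of unity of odd order cannot be opposite: the `n`th power of `-q ^ β` is `-1`.
  have hab : qpow q α + qpow q β ≠ 0 := by
    intro h0
    have h1 : qpow q α ^ n = (-qpow q β) ^ n := by rw [eq_neg_of_add_eq_zero_left h0]
    rw [hodd.neg_pow, qpow_pow hq, qpow_pow hq] at h1
    norm_num at h1
  -- The sum of the inverses is the sum divided by the product. Equal nonzero sums and equal sums of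
  -- inverses give equal products, so both pairs are the roots of one quadratic.
  have hprod : qpow q α * qpow q β = qpow q γ * qpow q δ := by
    field_simp at h'
    refine mul_left_cancel₀ hab ?_
    linear_combination -h' + qpow q α * qpow q β * h
  have hroot : (qpow q α - qpow q γ) * (qpow q α - qpow q δ) = 0 := by
    linear_combination qpow q α * h - hprod
  rcases mul_eq_zero.mp hroot with h1 | h1
  · have h2 := sub_eq_zero.mp h1
    rw [h2, add_right_inj] at h
    exact .inl ⟨hinj h2, hinj h⟩
  · have h2 := sub_eq_zero.mp h1
    rw [h2, add_comm, add_left_inj] at h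
    exact .inr ⟨hinj h2, hinj h⟩

end RootsOfUnity

/-! ## Eigenvectors of the McKay matrix -/

section Eigenvectors

variable {k : Type*} [Field k] {n : ℕ} [NeZero n] {q : k}
  [hq : Fact (IsPrimitiveRoot q n)]

lemma entry_chebVec (j r : ZMod n) {m : ℕ} (hm : m < n) (s : ZMod n) :
    entry (chebVec q j r) (m + 1) s =
      qpow q r ^ m * chebU m (qpow q j + (qpow q j)⁻¹) * qpow q (2 * r * s) := by
  have hmem : m + 1 ∈ Finset.Icc 1 n := Finset.mem_Icc.mpr ⟨by omega, by omega⟩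
  rw [entry, dif_pos hmem, chebVec, qpow_natCast_mul hq.out, qpow_neg hq.out]
  rfl

/-- The Fourier coefficients of the rows of a vector. -/
def fourier (q : k) (w : SimpleIdx n → k) (r : ZMod n) (l : ℕ) : k :=
  ∑ s : ZMod n, qpow q (-(2 * r * s)) * entry w l s

/-- The shift in `s` becomes multiplication by `q ^ (2 r)`, which is what decouples the recursion.
-/
lemma fourier_shift (w : SimpleIdx n → k) (r : ZMod n) (l : ℕ) :
    ∑ s : ZMod n, qpow q (-(2 * r * s)) * entry w l (s + 1) =
      qpow q r ^ 2 * fourier q w r l := by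
  have hq' := hq.out
  rw [fourier, Finset.mul_sum, ← Equiv.sum_comp (Equiv.addRight (1 : ZMod n))
    (fun s => qpow q r ^ 2 * (qpow q (-(2 * r * s)) * entry w l s))]
  refine Finset.sum_congr rfl fun s _ => ?_
  rw [Equiv.coe_addRight, ← mul_assoc, ← qpow_natCast_mul hq', ← qpow_add hq']
  congr 2
  push_cast
  ring

lemma fourier_inversion (hodd : Odd n) (w : SimpleIdx n → k) (l : ℕ) (s : ZMod n) :
    ∑ r : ZMod n, qpow q (2 * r * s) * fourier q w r l = n * entry w l s := by
  have hq' := hq.out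
  simp only [fourier, Finset.mul_sum]
  rw [Finset.sum_comm, Finset.sum_eq_single s]
  · have h : ∀ r : ZMod n, qpow q (2 * r * s) * (qpow q (-(2 * r * s)) * entry w l s) =
        entry w l s := fun r => by rw [← mul_assoc, qpow_mul_qpow_neg hq', one_mul]
    simp [h, ZMod.card]
  · intro s' _ hs
    have h : ∀ r : ZMod n, qpow q (2 * r * s) * (qpow q (-(2 * r * s')) * entry w l s') =
        qpow q (2 * r * (s - s')) * entry w l s' := fun r => by
      rw [← mul_assoc, ← qpow_add hq', mul_sub, sub_eq_add_neg]
    rw [Finset.sum_congr rfl fun r _ => h r, ← Finset.sum_mul, sum_qpow_mul hodd hq',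
      if_neg (sub_ne_zero.mpr hs.symm), zero_mul]
  · simp

lemma fourier_add_two (h2 : 2 ≤ n) {w : SimpleIdx n → k} {μ : k}
    (hw : (mcKay n q (simpleRep n q 2 h2 0)).mulVec w = μ • w) (r : ZMod n)
    {m : ℕ} (hm : m + 1 < n) :
    fourier q w r (m + 2) + qpow q r ^ 2 * fourier q w r m = μ * fourier q w r (m + 1) := by
  have h := ((mcKay_mulVec_eq_smul_iff h2 w μ).mp hw).1 m hm
  rw [← fourier_shift, fourier, fourier, ← Finset.sum_add_distrib, Finset.mul_sum]
  refine Finset.sum_congr rfl fun s _ => ?_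
  rw [← mul_add, h]
  ring

lemma fourier_last (h2 : 2 ≤ n) {w : SimpleIdx n → k} {μ : k}
    (hw : (mcKay n q (simpleRep n q 2 h2 0)).mulVec w = μ • w) (r : ZMod n) :
    2 * (qpow q r ^ 2 * fourier q w r (n - 1)) + 2 * fourier q w r 1 = μ * fourier q w r n := by
  have h := ((mcKay_mulVec_eq_smul_iff h2 w μ).mp hw).2
  rw [← fourier_shift, fourier, fourier, Finset.mul_sum, Finset.mul_sum, Finset.mul_sum,
    ← Finset.sum_add_distrib]
  refine Finset.sum_congr rfl fun s _ => ?_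
  linear_combination qpow q (-(2 * r * s)) * h s

/-! ### Solving the eigenvector equation in each Fourier mode -/

variable [CharZero k]

lemma chebVec_ne_zero (j r : ZMod n) : chebVec q j r ≠ 0 := by
  intro h
  have h1 := entry_chebVec (q := q) j r (NeZero.pos n) 0
  rw [h] at h1
  simp [entry, chebU_zero, qpow_zero] at h1

lemma mulVec_chebVec (h2 : 2 ≤ n) (j r : ZMod n) :
    (mcKay n q (simpleRep n q 2 h2 0)).mulVec (chebVec q j r) = lam q j r • chebVec q j r := by
  have hq' := hq.out
  have hshift : ∀ s, qpow q (2 * r * (s + 1)) = qpow q r ^ 2 * qpow q (2 * r * s) := by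
    intro s
    rw [← qpow_natCast_mul hq', ← qpow_add hq']
    congr 1
    push_cast
    ring
  rw [mcKay_mulVec_eq_smul_iff h2, lam, qpow_neg hq']
  refine ⟨fun m hm s => ?_, fun s => ?_⟩
  · rw [entry_chebVec j r hm, entry_chebVec j r (by omega)]
    cases m with
    | zero =>
      rw [entry_zero, chebU_one, chebU_zero]
      ring
    | succ m =>
      rw [entry_chebVec j r (by omega), chebU_add_two, hshift]
      ring
  · obtain ⟨m, rfl⟩ : ∃ m, n = m + 2 := ⟨n - 2, by omega⟩
    -- The closing equation holds because `q ^ j` is an `n`th root of unity; `(q ^ r) ^ n = 1`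
    -- matches the powers of `q ^ r` on the two sides.
    have h := (chebU_last_iff (qpow_ne_zero hq' j) m).mpr (qpow_pow hq' j)
    have hr := qpow_pow hq' r
    rw [show m + 2 - 1 = m + 1 by omega, entry_chebVec j r (by omega), entry_chebVec j r (by omega),
      entry_chebVec j r (m := m + 1) (by omega), hshift, chebU_zero]
    linear_combination (-qpow q r ^ (m + 2) * qpow q (2 * r * s)) * h -
      2 * qpow q (2 * r * s) * hr

lemma hasEigenvector_chebVec (h2 : 2 ≤ n) (j r : ZMod n) :
    Module.End.HasEigenvector (mcKay n q (simpleRep n q 2 h2 0)).mulVecLin (lam q j r)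
      (chebVec q j r) :=
  ⟨Module.End.mem_eigenspace_iff.mpr (mulVec_chebVec h2 j r), chebVec_ne_zero j r⟩

/-- Division by `(q ^ r) ^ m` turns the recursion of mode `r` into the Chebyshev one. The value at
`ℓ = 0` is zero, so the whole mode is determined by its value at `ℓ = 1`. -/
lemma fourier_eq_chebU (h2 : 2 ≤ n) {w : SimpleIdx n → k} {μ : k}
    (hw : (mcKay n q (simpleRep n q 2 h2 0)).mulVec w = μ • w) (r : ZMod n)
    {m : ℕ} (hm : m < n) :
    fourier q w r (m + 1) =
      qpow q r ^ m * chebU m (μ / qpow q r) * fourier q w r 1 := by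
  have hr := qpow_ne_zero hq.out r
  have h0 : fourier q w r 0 = 0 := by simp [fourier, entry_zero]
  induction m using Nat.twoStepInduction with
  | zero => simp [chebU_zero]
  | one =>
    have h := fourier_add_two h2 hw r (m := 0) hm
    rw [h0, mul_zero, add_zero] at h
    rw [h, chebU_one, pow_one, mul_div_cancel₀ _ hr, zero_add]
  | more m ih1 ih2 =>
    have h := fourier_add_two h2 hw r (m := m + 1) hm
    rw [ih1 (by omega), ih2 (by omega)] at h
    rw [show m + 2 + 1 = m + 1 + 2 by omega, eq_sub_of_add_eq h, chebU_add_two]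
    generalize chebU (m + 1) (μ / qpow q r) = A
    generalize chebU m (μ / qpow q r) = B
    field_simp
    ring

/-- Over an algebraically closed field `μ / q ^ r = z + z⁻¹` for some `z`. In a nonzero mode the
closing equation can be divided by the value at `ℓ = 1`, and it then says that `z ^ n = 1`, so `z`
is a power of `q`. -/
lemma exists_eq_lam [IsAlgClosed k] (h2 : 2 ≤ n) {w : SimpleIdx n → k} {μ : k}
    (hw : (mcKay n q (simpleRep n q 2 h2 0)).mulVec w = μ • w) (r : ZMod n)
    (h1 : fourier q w r 1 ≠ 0) : ∃ j : ZMod n, μ = lam q j r := by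
  have hq' := hq.out
  have hr := qpow_ne_zero hq' r
  obtain ⟨m, hm⟩ : ∃ m, n = m + 2 := ⟨n - 2, by omega⟩
  obtain ⟨z, hz0, hz⟩ : ∃ z : k, z ≠ 0 ∧ μ / qpow q r = z + z⁻¹ := by
    obtain ⟨z, hz⟩ := IsAlgClosed.exists_eval₂_eq_zero (RingHom.id k)
      (Polynomial.X ^ 2 - Polynomial.C (μ / qpow q r) * Polynomial.X + 1) (by
        have : (Polynomial.X ^ 2 - Polynomial.C (μ / qpow q r) * Polynomial.X + 1 :
          Polynomial k).degree = 2 := by compute_degree!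
        rw [this]
        exact two_ne_zero)
    simp only [Polynomial.eval₂_add, Polynomial.eval₂_sub, Polynomial.eval₂_mul,
      Polynomial.eval₂_pow, Polynomial.eval₂_X, Polynomial.eval₂_C, Polynomial.eval₂_one,
      RingHom.id_apply] at hz
    have hz0 : z ≠ 0 := by
      rintro rfl
      simp at hz
    refine ⟨z, hz0, mul_right_cancel₀ hz0 ?_⟩
    rw [add_mul, inv_mul_cancel₀ hz0]
    linear_combination -hz
  have hlast := fourier_last h2 hw r
  have hrn : qpow q r ^ (m + 2) = 1 := by rw [← hm, qpow_pow hq']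
  have e1 := fourier_eq_chebU h2 hw r (m := m) (by omega)
  have e2 := fourier_eq_chebU h2 hw r (m := m + 1) (by omega)
  rw [show m + 1 = n - 1 by omega] at e1
  rw [show m + 1 + 1 = n by omega] at e2
  rw [e1, e2, hz] at hlast
  have hμ : μ = qpow q r * (z + z⁻¹) := by rw [← hz, mul_div_cancel₀ _ hr]
  have hzn : z ^ n = 1 := by
    rw [hm, ← chebU_last_iff hz0]
    refine mul_left_cancel₀ h1 ?_
    rw [hμ] at hlast
    generalize chebU (m + 1) (z + z⁻¹) = A at *
    generalize chebU m (z + z⁻¹) = B at *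
    linear_combination -hlast - fourier q w r 1 * ((z + z⁻¹) * A - 2 * B) * hrn
  obtain ⟨i, -, rfl⟩ := hq'.eq_pow_of_pow_eq_one hzn
  refine ⟨(i : ZMod n), ?_⟩
  rw [lam, qpow_neg hq', qpow_natCast hq', hμ]

/-- The exponents in `λ_{j,r} = q ^ (r + j) + q ^ (r - j)` are determined up to order, and their sum
is `2 r`. -/
lemma eq_of_lam_eq (hodd : Odd n) {j r j' r' : ZMod n} (h : lam q j r = lam q j' r') : r = r' := by
  have hq' := hq.out
  simp only [lam, mul_add, ← qpow_add hq'] at h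
  refine two_mul_cancel hodd ?_
  rcases eq_or_eq_of_qpow_add hodd hq' h with ⟨h1, h3⟩ | ⟨h1, h3⟩ <;>
    linear_combination h1 + h3

/-- Every eigenvector of the McKay matrix is a multiple of one of the vectors `v_{j,r}`. -/
lemma exists_eq_smul_chebVec [IsAlgClosed k] (hodd : Odd n) (h2 : 2 ≤ n) {w : SimpleIdx n → k}
    {μ : k} (hw0 : w ≠ 0) (hw : (mcKay n q (simpleRep n q 2 h2 0)).mulVec w = μ • w) :
    ∃ (j r : ZMod n) (z : k), z ≠ 0 ∧ w = z • chebVec q j r := by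
  have hq' := hq.out
  have hn0 : (n : k) ≠ 0 := NeZero.ne _
  have hzero : ∀ r, fourier q w r 1 = 0 → ∀ m < n, fourier q w r (m + 1) = 0 := fun r hr m hm => by
    rw [fourier_eq_chebU h2 hw r hm, hr, mul_zero]
  -- If every mode vanished at `ℓ = 1`, it would vanish everywhere, and inversion would give `w =
  -- 0`.
  obtain ⟨r, hr⟩ : ∃ r, fourier q w r 1 ≠ 0 := by
    by_contra! hall
    refine hw0 (funext fun p => ?_)
    have hp := Finset.mem_Icc.mp p.1.2
    have h := fourier_inversion (q := q) hodd w p.1 p.2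
    rw [Finset.sum_eq_zero fun r _ => ?_, entry_of_mem] at h
    · exact (mul_eq_zero.mp h.symm).resolve_left hn0
    · have h3 := hzero r (hall r) (p.1 - 1) (by omega)
      rw [show (p.1 : ℕ) - 1 + 1 = p.1 by omega] at h3
      rw [h3, mul_zero]
  obtain ⟨j, hj⟩ := exists_eq_lam h2 hw r hr
  -- The scalar is read off from Fourier inversion, where only mode `r` contributes: a second
  -- nonzero mode `r'` would give the same eigenvalue as `λ_{j',r'}`.
  refine ⟨j, r, fourier q w r 1 / n, div_ne_zero hr hn0, funext fun p => ?_⟩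
  have hp := Finset.mem_Icc.mp p.1.2
  obtain ⟨m, hm⟩ : ∃ m, (p.1 : ℕ) = m + 1 := ⟨p.1 - 1, by omega⟩
  have hmn : m < n := by omega
  have h := fourier_inversion (q := q) hodd w p.1 p.2
  rw [Finset.sum_eq_single r, hm, fourier_eq_chebU h2 hw r hmn, hj, lam,
    mul_div_cancel_left₀ _ (qpow_ne_zero hq' r), qpow_neg hq'] at h
  · rw [Pi.smul_apply, smul_eq_mul, ← entry_of_mem w, ← entry_of_mem (chebVec q j r), hm,
      entry_chebVec j r hmn, div_mul_eq_mul_div, eq_div_iff hn0, mul_comm _ (n : k), ← h]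
    ring
  · intro r' _ hr'
    have h3 : fourier q w r' 1 = 0 := by
      by_contra hne
      obtain ⟨j', hj'⟩ := exists_eq_lam h2 hw r' hne
      exact hr' (eq_of_lam_eq hodd (hj'.symm.trans hj))
    rw [hm, hzero r' h3 m hmn, mul_zero]
  · simp

end Eigenvectors

/-! ## Trace vectors of group-like elements -/

section TraceVectors

variable {k : Type*} [Field k] {n : ℕ} [NeZero n] {q : k}
  [hq : Fact (IsPrimitiveRoot q n)]

lemma lam_eq_of_halves (hodd : Odd n) (h2 : 2 ≤ n) {i m j r : ZMod n} (h : Halves i m j r) :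
    lam q j r = eta n q 2 h2 0 (grp n q i m) := by
  have hq' := hq.out
  rw [eta_two_grp, lam, mul_add, ← qpow_add hq', ← qpow_add hq']
  rcases (halves_iff hodd i m j r).mp h with ⟨rfl, rfl⟩ | ⟨rfl, rfl⟩
  · congr 2 <;> ring
  · rw [add_comm]
    congr 2 <;> ring

variable [CharZero k]

/-- The second alternative is the first with `-j` in place of `j`, and `q ^ j + q ^ (-j)` does not
change. -/
lemma eta_grp_of_halves (hodd : Odd n) {i m j r : ZMod n} (h : Halves i m j r) {l : ℕ}
    (h1 : 1 ≤ l) (hl : l ≤ n) (s : ZMod n) :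
    eta n q l hl s (grp n q i m) = qpow q (((l : ZMod n) + 2 * s - 1) * r) *
      chebU (l - 1) (qpow q j + qpow q (-j)) := by
  rcases (halves_iff hodd i m j r).mp h with ⟨rfl, rfl⟩ | ⟨rfl, rfl⟩
  · exact eta_grp_eq_chebU h1 hl s j r
  · rw [eta_grp_eq_chebU h1 hl s (-j) r, neg_neg, add_comm (qpow q (-j))]

lemma traceVec_grp_of_halves (hodd : Odd n) {i m j r : ZMod n} (h : Halves i m j r) :
    traceVec n q (grp n q i m) = chebVec q j r := by
  have hq' := hq.out
  ext p
  have h1 := (Finset.mem_Icc.mp p.1.2).1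
  rw [traceVec, eta_grp_of_halves hodd h h1, chebVec, mul_right_comm, ← qpow_add hq']
  congr 2
  rw [Nat.cast_sub h1, Nat.cast_one]
  ring

lemma eta_grp_symm (hodd : Odd n) (i m : ZMod n) {l : ℕ} (h1 : 1 ≤ l) (hl : l ≤ n) (s : ZMod n) :
    eta n q l hl s (grp n q i m) = eta n q l hl s (grp n q (-m) (-i)) := by
  obtain ⟨j, r, -, h⟩ := exists_halves hodd i m
  rw [eta_grp_of_halves hodd h h1, eta_grp_of_halves hodd h.symm h1]

lemma traceVec_grp_symm (hodd : Odd n) (i m : ZMod n) :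
    traceVec n q (grp n q i m) = traceVec n q (grp n q (-m) (-i)) :=
  funext fun p => eta_grp_symm hodd i m (Finset.mem_Icc.mp p.1.2).1 _ _

lemma hasEigenvector_traceVec (hodd : Odd n) (h2 : 2 ≤ n) (i m : ZMod n) :
    Module.End.HasEigenvector (mcKay n q (simpleRep n q 2 h2 0)).mulVecLin
      (eta n q 2 h2 0 (grp n q i m)) (traceVec n q (grp n q i m)) := by
  obtain ⟨j, r, -, h⟩ := exists_halves hodd i m
  rw [← lam_eq_of_halves hodd h2 h, traceVec_grp_of_halves hodd h]
  exact hasEigenvector_chebVec h2 _ r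

/-- The eigenvalue `q ^ i + q ^ (-m)` determines the unordered pair `{i, -m}`. -/
lemma eta_two_eq_iff (hodd : Odd n) (h2 : 2 ≤ n) (i m i' m' : ZMod n) :
    eta n q 2 h2 0 (grp n q i m) = eta n q 2 h2 0 (grp n q i' m') ↔
      (i = i' ∧ m = m') ∨ (i = -m' ∧ m = -i') := by
  rw [eta_two_grp, eta_two_grp]
  constructor
  · intro h
    refine (eq_or_eq_of_qpow_add hodd hq.out h).imp (fun h => ⟨h.1, neg_injective h.2⟩)
      fun h => ⟨h.1, neg_eq_iff_eq_neg.mp h.2⟩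
  · rintro (⟨rfl, rfl⟩ | ⟨rfl, rfl⟩)
    · rfl
    · rw [neg_neg, add_comm]

/-- The eigenvalue is the `(2, 0)` entry of the trace vector. Equal vectors thus have equal
eigenvalues, and the pairs with equal eigenvalues are exactly those related by the symmetry. -/
lemma traceVec_eq_iff (hodd : Odd n) (h2 : 2 ≤ n) (i m i' m' : ZMod n) :
    traceVec n q (grp n q i m) = traceVec n q (grp n q i' m') ↔
      (i = i' ∧ m = m') ∨ (i = -m' ∧ m = -i') := by
  constructor
  · intro h
    rw [← eta_two_eq_iff (q := q) hodd h2]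
    exact congrFun h (⟨2, Finset.mem_Icc.mpr ⟨one_le_two, h2⟩⟩, 0)
  · rintro (⟨rfl, rfl⟩ | ⟨rfl, rfl⟩)
    · rfl
    · rw [← traceVec_grp_symm hodd]

lemma ncard_range_traceVec (hodd : Odd n) (h2 : 2 ≤ n) :
    (Set.range fun p : ZMod n × ZMod n => traceVec n q (grp n q p.1 p.2)).ncard =
      n * (n + 1) / 2 := by
  -- The sign in the second exponent turns the symmetry `(i, k) ↦ (-k, -i)` into the exchange of the
  -- entries of `{i, -k}`, so that the trace vectors are counted by unordered pairs with repetition.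
  let f : Sym2 (ZMod n) → (SimpleIdx n → k) :=
    Sym2.lift ⟨fun x y => traceVec n q (grp n q x (-y)), fun x y => by
      dsimp only
      rw [traceVec_grp_symm hodd, neg_neg]⟩
  have hf : Function.Injective f := by
    intro u v
    induction u using Sym2.ind with | _ x y => ?_
    induction v using Sym2.ind with | _ x' y' => ?_
    intro h
    rw [Sym2.eq_iff]
    refine ((traceVec_eq_iff (q := q) hodd h2 _ _ _ _).mp h).imp
      (fun h => ⟨h.1, neg_injective h.2⟩) fun h => ⟨h.1.trans (neg_neg _), neg_injective h.2⟩
  have hrange : (Set.range fun p : ZMod n × ZMod n => traceVec n q (grp n q p.1 p.2)) =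
      Set.range f := by
    ext v
    constructor
    · rintro ⟨⟨x, y⟩, rfl⟩
      exact ⟨s(x, -y), by simp [f]⟩
    · rintro ⟨u, rfl⟩
      induction u using Sym2.ind with | _ x y => ?_
      exact ⟨(x, -y), rfl⟩
  rw [hrange, ← Nat.card_coe_set_eq, Nat.card_range_of_injective hf, Nat.card_eq_fintype_card,
    Sym2.card, ZMod.card, Nat.choose_two_right, Nat.add_sub_cancel, mul_comm]

end TraceVectors

end DAlg

end

theorem theorem3p6 {𝕜 : Type*} [Field 𝕜] [IsAlgClosed 𝕜] [CharZero 𝕜]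
    (n : ℕ) [NeZero n] (hodd : Odd n) (hn : 3 ≤ n)
    (q : 𝕜) [hq : Fact (IsPrimitiveRoot q n)] :
    -- trace vectors of the grouplike elements are eigenvectors; the eigenvalue in terms of `j, r`
    (∀ i k : ZMod n,
      Module.End.HasEigenvector
        (DAlg.mcKay n q (DAlg.simpleRep n q 2 (by omega) 0)).mulVecLin
        (DAlg.eta n q 2 (by omega) 0 (DAlg.grp n q i k))
        (DAlg.traceVec n q (DAlg.grp n q i k)) ∧
      DAlg.eta n q 2 (by omega) 0 (DAlg.grp n q i k) = DAlg.qpow q i + DAlg.qpow q (-k) ∧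
      (∃ (j : ℕ) (r : ZMod n), j ≤ (n - 1) / 2 ∧ DAlg.Halves i k (j : ZMod n) r) ∧
      ∀ j r : ZMod n,
        (DAlg.Halves i k j r →
          DAlg.lam q j r = DAlg.eta n q 2 (by omega) 0 (DAlg.grp n q i k)) ∧
        (DAlg.Halves i k j r ↔
          (i = j + r ∧ k = j - r) ∨ (i = -j + r ∧ k = -j - r))) ∧
    -- trace vectors and character values through Chebyshev polynomials
    (∀ i k j r : ZMod n, DAlg.Halves i k j r →
      DAlg.traceVec n q (DAlg.grp n q i k) = DAlg.chebVec q j r ∧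
      ∀ (l : ℕ) (_ : 1 ≤ l) (hl : l ≤ n) (s : ZMod n),
        DAlg.eta n q l hl s (DAlg.grp n q i k) =
          DAlg.qpow q (((l : ZMod n) + 2 * s - 1) * r) *
            DAlg.chebU (l - 1) (DAlg.qpow q j + DAlg.qpow q (-j))) ∧
    -- the symmetry `b ^ i c ^ k ↔ b ^ (-k) c ^ (-i)`
    (∀ i k : ZMod n,
      DAlg.traceVec n q (DAlg.grp n q i k) = DAlg.traceVec n q (DAlg.grp n q (-k) (-i)) ∧
      ∀ (l : ℕ) (_ : 1 ≤ l) (hl : l ≤ n) (s : ZMod n),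
        DAlg.eta n q l hl s (DAlg.grp n q i k) = DAlg.eta n q l hl s (DAlg.grp n q (-k) (-i))) ∧
    -- completeness of the trace vectors
    ((∀ (μ : 𝕜) (w : DAlg.SimpleIdx n → 𝕜),
        Module.End.HasEigenvector
          (DAlg.mcKay n q (DAlg.simpleRep n q 2 (by omega) 0)).mulVecLin μ w →
        ∃ (i k : ZMod n) (z : 𝕜), z ≠ 0 ∧ w = z • DAlg.traceVec n q (DAlg.grp n q i k)) ∧
      (∀ i k i' k' : ZMod n,
        DAlg.traceVec n q (DAlg.grp n q i k) ≠ DAlg.traceVec n q (DAlg.grp n q i' k') →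
        DAlg.eta n q 2 (by omega) 0 (DAlg.grp n q i k) ≠
          DAlg.eta n q 2 (by omega) 0 (DAlg.grp n q i' k')) ∧
      (Set.range fun p : ZMod n × ZMod n =>
        DAlg.traceVec n q (DAlg.grp n q p.1 p.2)).ncard = n * (n + 1) / 2) := by
  have h2 : 2 ≤ n := by omega
  refine ⟨fun i k => ⟨DAlg.hasEigenvector_traceVec hodd h2 i k, DAlg.eta_two_grp h2 i k,
      DAlg.exists_halves hodd i k, fun j r => ⟨DAlg.lam_eq_of_halves hodd h2,
        DAlg.halves_iff hodd i k j r⟩⟩,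
    fun i k j r h => ⟨DAlg.traceVec_grp_of_halves hodd h,
      fun l h1 hl s => DAlg.eta_grp_of_halves hodd h h1 hl s⟩,
    fun i k => ⟨DAlg.traceVec_grp_symm hodd i k,
      fun l h1 hl s => DAlg.eta_grp_symm hodd i k h1 hl s⟩,
    fun μ w hw => ?_, fun i k i' k' => mt fun h => ?_, DAlg.ncard_range_traceVec hodd h2⟩
  · obtain ⟨j, r, z, hz, h⟩ := DAlg.exists_eq_smul_chebVec hodd h2 hw.2
      (Module.End.mem_eigenspace_iff.mp hw.1)
    -- The exponents `i = j + r`, `k = j - r` are the first solution of the halving condition for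
    -- the given `j` and `r`.
    refine ⟨j + r, j - r, z, hz, ?_⟩
    rw [h, DAlg.traceVec_grp_of_halves hodd
      ((DAlg.halves_iff hodd _ _ j r).mpr (.inl ⟨rfl, rfl⟩))]
  · rw [DAlg.traceVec_eq_iff hodd h2]
    exact (DAlg.eta_two_eq_iff hodd h2 i k i' k').mp h
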